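/- Let $\mathsf{Comm}$ be the category of commutative $\mathbb{C}$-algebras (either all of them, or only the finitely generated ones; the statement holds for both choices), and let $\mathsf{Azu}$ be the category of the $\mathbb{C}$-algebras $A$ that are Azumaya over their center $Z(A)$, with $Z(A)\in\mathsf{Comm}$; its morphisms are the $\mathbb{C}$-algebra maps $h:A\to B$ with $h(Z(A))\subseteq Z(B)$. Let $\mathsf{D}$ be the poset of positive integers, with a morphism $m\to n$ if and only if $n\mid m$. An algebra $A$ that is Azumaya over $R$ is of constant degree $n$ if its rank is $n^2$ at every prime of $R$ (so the zero algebra over the zero ring is of every constant degree). Let $J$ be a Grothendieck topology on $\mathsf{Comm}^{\mathrm{op}}$ and $K$ a Grothendieck topology on $\mathsf{D}$. Let $A\in\mathsf{Azu}$ have center $C$ and let $S$ be a sieve on $A$ in $\mathsf{Azu}^{\mathrm{op}}$. For a morphism $f:C\to D$ of $\mathsf{Comm}$, a number $m\geq 1$ is *represented* on $f$ if there are $B\in\mathsf{Azu}$ of constant degree $m$ and a ring map $\varphi: A\otimes_C D\to B$ that maps $D$ bijectively onto $Z(B)$, such that the composite $A\to A\otimes_C D\to B$ belongs to $S$. The morphism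 $f$ is *centrally covered* if $A\otimes_C D$ is of some constant degree $n$ over $D$, and the multiples of $n$ that are represented on $f$ form a $K$-covering sieve on $n$. The sieve $S$ is *$J_K$-covering* if the centrally covered morphisms form a $J$-covering sieve on $C$. Theorem. Suppose that every $K$-covering sieve contains a finitely generated $K$-covering sieve, and suppose that 1. $J$ is finer than the étale topology, or 2. $J$ is finer than the Zariski topology and $K$ is stable under multiplication, that is, for every $K$-covering sieve $\{n_r\to n\}$ on $n$ and every $k\geq 1$, the sieve on $nk$ generated by $\{n_rk\to nk\}$ is $K$-covering. Then the $J_K$-covering sieves form a Grothendieck topology on $\mathsf{Azu}^{\mathrm{op}}$. Moreover, if two pairs $(J,K)$ and $(J',K')$ satisfy these assumptions, and the topologies $J_K$ and $J'_{K'}$ agree and are not the discrete topology (in which all sieves are covering), then $J=J'$ and $K=K'$. -/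

import Mathlib

open CategoryTheory Opposite TensorProduct

universe u

noncomputable section

namespace AzuTop

/-- The commutative algebras under consideration: those commutative `ℂ`-algebras that satisfy `P`,
with all `ℂ`-algebra maps between them. -/
abbrev Comm (P : ObjectProperty (CommAlgCat.{u} ℂ)) : Type (u + 1) := P.FullSubcategory

/-- The property of being finitely generated as a `ℂ`-algebra. -/
def finitelyGenerated : ObjectProperty (CommAlgCat.{u} ℂ) := fun C => Algebra.FiniteType ℂ C

/-- The ring map underlying a morphism of commutative algebras. -/
def Comm.ringHom {P : ObjectProperty (CommAlgCat.{u} ℂ)} {C D : Comm P} (f : C ⟶ D) :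
    C.obj →+* D.obj :=
  f.hom.hom.toRingHom

/-- An algebra as an algebra over its center. -/
instance centerAlgebra (A : Type u) [Ring A] [Algebra ℂ A] :
    Algebra (Subalgebra.center ℂ A) A where
  algebraMap := (Subalgebra.center ℂ A).val.toRingHom
  commutes' z a := (Subalgebra.mem_center_iff.mp z.2 a).symm
  smul_def' _ _ := rfl

/-- An algebra that is Azumaya over its center, the center being one of the commutative algebras
under consideration. (As an Azumaya algebra is a finite module over its center, it is finitely
generated as a `ℂ`-algebra if and only if its center is.) -/
structure Azu (P : ObjectProperty (CommAlgCat.{u} ℂ)) where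
  carrier : Type u
  [ring : Ring carrier]
  [algebra : Algebra ℂ carrier]
  isAzumaya : IsAzumaya (Subalgebra.center ℂ carrier) carrier
  center_prop : P (CommAlgCat.of ℂ (Subalgebra.center ℂ carrier))

namespace Azu

variable {P : ObjectProperty (CommAlgCat.{u} ℂ)}

instance : CoeSort (Azu P) (Type u) := ⟨Azu.carrier⟩

attribute [instance] Azu.ring Azu.algebra

/-- Morphisms of Azumaya algebras: the `ℂ`-algebra maps that send the center into the center. -/
@[ext]
structure Hom (A B : Azu P) where
  toAlgHom : A →ₐ[ℂ] B
  map_center : ∀ z ∈ Subalgebra.center ℂ A, toAlgHom z ∈ Subalgebra.center ℂ B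

instance : Category (Azu P) where
  Hom A B := Hom A B
  id A := ⟨AlgHom.id ℂ A, fun _ hz => hz⟩
  comp f g := ⟨g.toAlgHom.comp f.toAlgHom, fun z hz => g.map_center _ (f.map_center z hz)⟩

/-- The center of an Azumaya algebra. -/
def center (A : Azu P) : Comm P := ⟨CommAlgCat.of ℂ (Subalgebra.center ℂ A), A.center_prop⟩

end Azu

/-- An `R`-algebra `A` has constant degree `n` if its rank at each prime of `R` is `n ^ 2`.
(Used only if `A` is a finite projective `R`-module.) -/
def HasConstantDegree (R A : Type u) [CommRing R] [Ring A] [Algebra R A] (n : ℕ+) : Prop :=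
  ∀ p : PrimeSpectrum R, Module.rankAtStalk (R := R) A p = (n : ℕ) ^ 2

section Comm

variable (P : ObjectProperty (CommAlgCat.{u} ℂ))

/-- The Zariski covers of `C`: finite families of localizations `C → C[1/rᵢ]` such that the `rᵢ`
generate the unit ideal of `C`. -/
def zariskiCovers : Precoverage (Comm P)ᵒᵖ where
  coverings C := {R | ∃ (k : ℕ) (X : Fin k → Comm P) (g : ∀ i, C.unop ⟶ X i)
    (r : Fin k → C.unop.obj), Ideal.span (Set.range r) = ⊤ ∧
      (∀ i, @IsLocalization.Away C.unop.obj _ (r i) (X i).obj _ (Comm.ringHom (g i)).toAlgebra) ∧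
      R = Presieve.ofArrows (fun i => op (X i)) (fun i => (g i).op)}

/-- The étale covers of `C`: finite families of étale maps `C → Cᵢ` whose spectra jointly cover the
spectrum of `C`. -/
def etaleCovers : Precoverage (Comm P)ᵒᵖ where
  coverings C := {R | ∃ (k : ℕ) (X : Fin k → Comm P) (g : ∀ i, C.unop ⟶ X i),
      (∀ i, (Comm.ringHom (g i)).Etale) ∧
      (∀ p : PrimeSpectrum C.unop.obj, ∃ (i : Fin k) (q : PrimeSpectrum (X i).obj),
        PrimeSpectrum.comap (Comm.ringHom (g i)) q = p) ∧
      R = Presieve.ofArrows (fun i => op (X i)) (fun i => (g i).op)}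

/-- The Zariski topology: the Grothendieck topology generated by the Zariski covers. -/
def zariskiTopology : GrothendieckTopology (Comm P)ᵒᵖ := (zariskiCovers P).toGrothendieck

/-- The étale topology: the Grothendieck topology generated by the étale covers. -/
def etaleTopology : GrothendieckTopology (Comm P)ᵒᵖ := (etaleCovers P).toGrothendieck

end Comm

/-- The positive integers, ordered by divisibility as follows. -/
structure DivPoset : Type where
  val : ℕ+

namespace DivPoset

/-- There is a (unique) morphism `m ⟶ n` if and only if `n` divides `m`. -/
instance : PartialOrder DivPoset where
  le m n := n.val ∣ m.val
  le_refl _ := dvd_refl _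
  le_trans _ _ _ h h' := dvd_trans h' h
  le_antisymm a b h h' := by
    cases a; cases b
    exact congrArg DivPoset.mk (PNat.dvd_antisymm h' h)

/-- Every covering sieve contains a covering sieve that is generated by finitely many morphisms. -/
def FinitelyRefinable (K : GrothendieckTopology DivPoset) : Prop :=
  ∀ (n : DivPoset) (S : Sieve n), S ∈ K n →
    ∃ (k : ℕ) (m : Fin k → DivPoset) (g : ∀ i, m i ⟶ n),
      Sieve.ofArrows m g ≤ S ∧ Sieve.ofArrows m g ∈ K n

/-- If the `m ⟶ n` in `S` cover `n`, then the `m * k ⟶ n * k` cover `n * k`. -/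
def StableUnderMul (K : GrothendieckTopology DivPoset) : Prop :=
  ∀ (n : DivPoset) (S : Sieve n), S ∈ K n → ∀ k : ℕ+,
    Sieve.generate (fun (l : DivPoset) (_ : l ⟶ ⟨n.val * k⟩) =>
      ∃ (m : DivPoset) (f : m ⟶ n), S f ∧ l = ⟨m.val * k⟩) ∈ K ⟨n.val * k⟩

end DivPoset

section Covering

variable {P : ObjectProperty (CommAlgCat.{u} ℂ)}

/-- For an Azumaya algebra `A` with center `C` and `f : C ⟶ D`: the algebra `A ⊗_C D`, written with
`D` on the left, has constant degree `n` over `D`. -/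
def BaseChangeHasDegree (A : Azu P) {D : Comm P} (f : A.center ⟶ D) (n : ℕ+) : Prop :=
  letI : Algebra (Subalgebra.center ℂ A) D.obj := (Comm.ringHom f).toAlgebra
  HasConstantDegree D.obj (D.obj ⊗[Subalgebra.center ℂ A] A) n

/-- The number `m` is represented on `f : C ⟶ D`: the sieve `S` contains a central extension
`φ : A ⊗_C D → B`, that is a ring map that identifies `D` with the center of `B`, where the
Azumaya algebra `B` is of constant degree `m` over its center. -/
def Represented (A : Azu P) (S : Sieve (op A)) {D : Comm P} (f : A.center ⟶ D) (m : ℕ+) : Prop :=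
  letI : Algebra (Subalgebra.center ℂ A) D.obj := (Comm.ringHom f).toAlgebra
  ∃ (B : Azu P) (φ : D.obj ⊗[Subalgebra.center ℂ A] A →+* B) (h : A ⟶ B),
    Set.BijOn (fun d : D.obj => φ (d ⊗ₜ 1)) Set.univ (Subalgebra.center ℂ B) ∧
    (∀ a : A, φ (1 ⊗ₜ a) = h.toAlgHom a) ∧
    S h.op ∧
    HasConstantDegree (Subalgebra.center ℂ B) B m

/-- `f : C ⟶ D` is centrally covered: `A ⊗_C D` is of some constant degree `n`, and the numbers
represented on `f` form a `K`-covering sieve on `n`. -/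
def CentrallyCovered (K : GrothendieckTopology DivPoset) (A : Azu P) (S : Sieve (op A))
    {D : Comm P} (f : A.center ⟶ D) : Prop :=
  ∃ n : ℕ+, BaseChangeHasDegree A f n ∧
    ∃ T : Sieve (⟨n⟩ : DivPoset), T ∈ K ⟨n⟩ ∧
      ∀ (m : DivPoset) (g : m ⟶ ⟨n⟩), T g ↔ Represented A S f m.val

/-- `S` is a `J_K`-covering sieve: the centrally covered morphisms form a `J`-covering sieve. -/
def JKCovering (J : GrothendieckTopology (Comm P)ᵒᵖ) (K : GrothendieckTopology DivPoset)
    (A : Azu P) (S : Sieve (op A)) : Prop :=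
  ∃ T : Sieve (op A.center), T ∈ J (op A.center) ∧
    ∀ (D : Comm P) (f : A.center ⟶ D), T f.op ↔ CentrallyCovered K A S f

/-- The covering sieves of the topology `T` are the `J_K`-covering sieves. -/
def IsTopologyJK (J : GrothendieckTopology (Comm P)ᵒᵖ) (K : GrothendieckTopology DivPoset)
    (T : GrothendieckTopology (Azu P)ᵒᵖ) : Prop :=
  ∀ (A : Azu P) (S : Sieve (op A)), S ∈ T (op A) ↔ JKCovering J K A S

/-- The standing assumptions on the pair `(J, K)`. -/
def Admissible (J : GrothendieckTopology (Comm P)ᵒᵖ) (K : GrothendieckTopology DivPoset) : Prop :=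
  DivPoset.FinitelyRefinable K ∧
    (etaleTopology P ≤ J ∨ (zariskiTopology P ≤ J ∧ DivPoset.StableUnderMul K))

end Covering

end AzuTop

end

noncomputable section

namespace AzuTop

section DualBasis

variable {R S : Type*} [CommRing R] [CommRing S] [Algebra R S]

lemma exists_dualBasis (R N : Type*) [CommRing R] [AddCommGroup N] [Module R N] [Module.Finite R N]
    [Module.Projective R N] :
    ∃ (n : ℕ) (x : Fin n → N) (f : Fin n → N →ₗ[R] R), ∀ y, ∑ i, f i y • x i = y := by
  obtain ⟨n, f, g, -, -, h⟩ := Module.Finite.exists_comp_eq_id_of_projective R N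
  refine ⟨n, fun i => f (Pi.single i 1), fun i => LinearMap.proj i ∘ₗ g, fun y => ?_⟩
  conv_rhs => rw [← LinearMap.id_apply (R := R) y, ← h, LinearMap.comp_apply,
    pi_eq_sum_univ' (g y), map_sum]
  refine Finset.sum_congr rfl fun i _ => ?_
  rw [map_smul]
  congr 2

/-- The contraction of the second factor of a tensor product by a functional. -/
def contractRight {M N : Type*} [AddCommGroup M] [Module R M] [Module S M] [IsScalarTower R S M]
    [AddCommGroup N] [Module R N] (f : N →ₗ[R] R) : M ⊗[R] N →ₗ[S] M :=
  (AlgebraTensorModule.rid R S M).toLinearMap ∘ₗ AlgebraTensorModule.map LinearMap.id f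

@[simp]
lemma contractRight_tmul {M N : Type*} [AddCommGroup M] [Module R M] [Module S M]
    [IsScalarTower R S M] [AddCommGroup N] [Module R N] (f : N →ₗ[R] R) (m : M) (y : N) :
    contractRight (S := S) f (m ⊗ₜ[R] y) = f y • m := by
  simp [contractRight]

lemma endTensorEnd_bijective {M N : Type*} [AddCommGroup M] [Module R M] [Module S M]
    [IsScalarTower R S M] [AddCommGroup N] [Module R N] [Module.Finite R N]
    [Module.Projective R N] :
    Function.Bijective (Module.endTensorEndAlgHom (R := R) (S := S) (A := S) (M := M) (N := N)) := by
  obtain ⟨n, x, f, hf⟩ := exists_dualBasis R N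
  rw [Function.bijective_iff_has_inverse]
  refine ⟨fun F => ∑ i, ∑ j, (contractRight (f j) ∘ₗ F ∘ₗ
      (AlgebraTensorModule.mk R S M N).flip (x i)) ⊗ₜ[R] (LinearMap.toSpanSingleton R N (x j) ∘ₗ f i),
    fun t => ?_, fun F => ?_⟩
  · induction t with
    | zero => simp
    | add a b ha hb =>
      simp only [map_add, LinearMap.add_comp, LinearMap.comp_add, TensorProduct.add_tmul,
        Finset.sum_add_distrib] at ha hb ⊢
      rw [ha, hb]
    | tmul g h =>
      have key : ∀ i j, (contractRight (f j) ∘ₗ (Module.endTensorEndAlgHom (R := R) (S := S) (A := S)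
          (M := M) (N := N) (g ⊗ₜ[R] h)) ∘ₗ (AlgebraTensorModule.mk R S M N).flip (x i)) =
          f j (h (x i)) • g := by
        intro i j
        ext m
        change contractRight (f j) (AlgebraTensorModule.map g h (m ⊗ₜ[R] x i)) = _
        simp
      simp only [key, TensorProduct.smul_tmul, ← TensorProduct.tmul_sum]
      congr 1
      ext y
      simp only [LinearMap.sum_apply, LinearMap.smul_apply, LinearMap.comp_apply,
        LinearMap.toSpanSingleton_apply]
      conv_rhs => rw [← hf y, map_sum, ]
      refine Finset.sum_congr rfl fun i _ => ?_
      rw [map_smul]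
      conv_rhs => rw [← hf (h (x i)), Finset.smul_sum]
      exact Finset.sum_congr rfl fun j _ => smul_comm _ _ _
  · refine TensorProduct.AlgebraTensorModule.ext fun m y => ?_
    have h2 : ∀ w : M ⊗[R] N, ∑ j, contractRight (S := S) (f j) w ⊗ₜ[R] x j = w := by
      intro w
      induction w with
      | zero => simp
      | add a b ha hb => simp only [map_add, TensorProduct.add_tmul, Finset.sum_add_distrib, ha, hb]
      | tmul m y =>
        simp only [contractRight_tmul, TensorProduct.smul_tmul, ← TensorProduct.tmul_sum, hf]
    simp only [map_sum, LinearMap.sum_apply, Module.endTensorEndAlgHom_apply,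
      AlgebraTensorModule.map_tmul, LinearMap.comp_apply, LinearMap.flip_apply,
      LinearMap.toSpanSingleton_apply, AlgebraTensorModule.mk_apply]
    rw [← h2 (F (m ⊗ₜ y)), Finset.sum_comm]
    refine Finset.sum_congr rfl fun j _ => ?_
    conv_rhs => rw [← hf y]
    simp only [TensorProduct.tmul_sum, map_sum, TensorProduct.sum_tmul]
    refine Finset.sum_congr rfl fun i _ => ?_
    have e : contractRight (S := S) (f j) (F (m ⊗ₜ[R] (f i y • x i))) =
        f i y • contractRight (S := S) (f j) (F (m ⊗ₜ[R] x i)) := by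
      rw [TensorProduct.tmul_smul, ← algebraMap_smul S (f i y), map_smul, map_smul, algebraMap_smul]
    rw [e, ← TensorProduct.smul_tmul', TensorProduct.tmul_smul]
    rfl

end DualBasis

section Azumaya

variable (R A : Type*) [CommRing R] [Ring A] [Algebra R A]

lemma faithfullyFlat_of_isAzumaya [IsAzumaya R A] : Module.FaithfullyFlat R A := by
  rw [Module.FaithfullyFlat.iff_flat_and_ideal_smul_eq_top]
  refine ⟨inferInstance, fun I hI => ?_⟩
  obtain ⟨r, hr, h⟩ := Submodule.exists_sub_one_mem_and_smul_eq_zero_of_fg_of_le_smul I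
    (⊤ : Submodule R A) Module.Finite.fg_top hI.ge
  have h0 : r = 0 := by
    apply FaithfulSMul.eq_of_smul_eq_smul (α := A)
    intro a
    rw [h a trivial, zero_smul]
  rw [Ideal.eq_top_iff_one]
  simpa [h0] using hr

lemma faithfulSMul_of_faithfullyFlat [Module.FaithfullyFlat R A] : FaithfulSMul R A := by
  rw [faithfulSMul_iff_algebraMap_injective, injective_iff_map_eq_zero]
  intro r hr
  rw [← Module.FaithfullyFlat.one_tmul_eq_zero_iff R (A := A) (M := R) r]
  have : (1 : A) ⊗ₜ[R] r = (algebraMap R A r) ⊗ₜ[R] (1 : R) := by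
    rw [Algebra.algebraMap_eq_smul_one, TensorProduct.smul_tmul, smul_eq_mul, mul_one]
  rw [this, hr, TensorProduct.zero_tmul]

lemma exists_functional_one [IsAzumaya R A] : ∃ π : A →ₗ[R] R, π 1 = 1 := by
  obtain ⟨n, x, f, hf⟩ := exists_dualBasis R A
  have := faithfullyFlat_of_isAzumaya R A
  have h1 : (Ideal.span (Set.range fun i => f i 1)) = ⊤ := by
    apply ((Module.FaithfullyFlat.iff_flat_and_ideal_smul_eq_top R A).1 inferInstance).2
    rw [eq_top_iff]
    intro a _
    have ha : ∑ i, f i 1 • (a * x i) = a := by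
      conv_rhs => rw [← mul_one a, ← hf 1, Finset.mul_sum]
      simp only [mul_smul_comm]
    rw [← ha]
    refine Submodule.sum_mem _ fun i _ => ?_
    exact Submodule.smul_mem_smul (Ideal.subset_span ⟨i, rfl⟩) trivial
  obtain ⟨c, hc⟩ := (Submodule.mem_span_range_iff_exists_fun R).1 ((Ideal.eq_top_iff_one _).1 h1)
  exact ⟨∑ i, c i • f i, by simpa using hc⟩

variable {R A}

/-- The bimodule action of `A ⊗ Aᵒᵖ` on an algebra over `A`. -/
def bimoduleAction {B : Type*} [Ring B] [Algebra R B] (i : A →ₐ[R] B) :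
    A ⊗[R] Aᵐᵒᵖ →ₐ[R] Module.End R B :=
  (AlgHom.mulLeftRight R B).comp (Algebra.TensorProduct.map i i.op)

@[simp]
lemma bimoduleAction_tmul {B : Type*} [Ring B] [Algebra R B] (i : A →ₐ[R] B) (a : A) (a' : Aᵐᵒᵖ)
    (b : B) : bimoduleAction i (a ⊗ₜ a') b = i a * b * i a'.unop := by
  simp [bimoduleAction]

end Azumaya

end AzuTop

namespace AzuTop

section TensorAzumaya

variable {R S A B : Type*} [CommRing R] [CommRing S] [Algebra R S] [Ring A] [Algebra R A]
  [Algebra S A] [IsScalarTower R S A] [Ring B] [Algebra R B]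

variable (R S A B) in
/-- The rearrangement `(A ⊗ B) ⊗ (A ⊗ B)ᵒᵖ ≃ (A ⊗ Aᵒᵖ) ⊗ (B ⊗ Bᵒᵖ)`. -/
def envelopingTensorEquiv : (A ⊗[R] B) ⊗[S] (A ⊗[R] B)ᵐᵒᵖ ≃ₐ[S]
    (A ⊗[S] Aᵐᵒᵖ) ⊗[R] (B ⊗[R] Bᵐᵒᵖ) :=
  (Algebra.TensorProduct.congr AlgEquiv.refl (Algebra.TensorProduct.opAlgEquiv R S A B).symm).trans
    (Algebra.TensorProduct.tensorTensorTensorComm R R S S A B Aᵐᵒᵖ Bᵐᵒᵖ)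

variable (R S A B) in
lemma mulLeftRight_tensor :
    AlgHom.mulLeftRight S (A ⊗[R] B) =
      ((Module.endTensorEndAlgHom (R := R) (S := S) (A := S) (M := A) (N := B)).comp
        (Algebra.TensorProduct.map (AlgHom.mulLeftRight S A) (AlgHom.mulLeftRight R B))).comp
        (envelopingTensorEquiv R S A B).toAlgHom := by
  have h : ∀ (a a' x : A) (b b' y : B),
      AlgHom.mulLeftRight S (A ⊗[R] B) ((a ⊗ₜ b) ⊗ₜ MulOpposite.op (a' ⊗ₜ b')) (x ⊗ₜ y) =
      ((Module.endTensorEndAlgHom (R := R) (S := S) (A := S) (M := A) (N := B)).comp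
        (Algebra.TensorProduct.map (AlgHom.mulLeftRight S A) (AlgHom.mulLeftRight R B))).comp
        (envelopingTensorEquiv R S A B).toAlgHom
          ((a ⊗ₜ b) ⊗ₜ MulOpposite.op (a' ⊗ₜ b')) (x ⊗ₜ y) := by
    intro a a' x b b' y
    rw [AlgHom.mulLeftRight_apply]
    change _ = AlgebraTensorModule.map (AlgHom.mulLeftRight S A (a ⊗ₜ MulOpposite.op a'))
      (AlgHom.mulLeftRight R B (b ⊗ₜ MulOpposite.op b')) (x ⊗ₜ y)
    rw [AlgebraTensorModule.map_tmul, AlgHom.mulLeftRight_apply, AlgHom.mulLeftRight_apply]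
    simp
  refine AlgHom.ext fun t => ?_
  induction t with
  | zero => simp
  | add a b ha hb => rw [map_add, map_add, ha, hb]
  | tmul p q =>
    induction p with
    | zero => simp
    | add a b ha hb => rw [TensorProduct.add_tmul, map_add, map_add, ha, hb]
    | tmul a b =>
      induction q using MulOpposite.rec' with
      | h q =>
      induction q with
      | zero => simp
      | add c d hc hd =>
        rw [MulOpposite.op_add, TensorProduct.tmul_add, map_add, map_add, hc, hd]
      | tmul a' b' => exact TensorProduct.AlgebraTensorModule.ext fun x y => h a a' x b b' y

lemma faithfullyFlat_tensorProduct {M N : Type*} [AddCommGroup M] [Module R M] [AddCommGroup N]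
    [Module R N] [Module.FaithfullyFlat R M] [Module.FaithfullyFlat R N] :
    Module.FaithfullyFlat R (M ⊗[R] N) := by
  rw [Module.FaithfullyFlat.iff_flat_and_lTensor_faithful]
  refine ⟨inferInstance, fun L _ _ _ => ?_⟩
  exact (TensorProduct.assoc R M N L).toEquiv.nontrivial

lemma faithfullyFlat_tensor [Module.FaithfullyFlat S A] [Module.FaithfullyFlat R B] :
    Module.FaithfullyFlat S (A ⊗[R] B) := by
  have : Module.FaithfullyFlat S (A ⊗[S] (S ⊗[R] B)) := faithfullyFlat_tensorProduct
  exact Module.FaithfullyFlat.of_linearEquiv S (M := A ⊗[S] (S ⊗[R] B))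
    (N := A ⊗[R] B) (AlgebraTensorModule.cancelBaseChange R S S A B).symm

instance isAzumaya_tensor [IsAzumaya S A] [IsAzumaya R B] : IsAzumaya S (A ⊗[R] B) := by
  have := faithfullyFlat_of_isAzumaya S A
  have := faithfullyFlat_of_isAzumaya R B
  have : Module.FaithfullyFlat S (A ⊗[R] B) := faithfullyFlat_tensor
  have := faithfulSMul_of_faithfullyFlat S (A ⊗[R] B)
  have h1 : Module.Finite S (A ⊗[R] B) :=
    Module.Finite.equiv (AlgebraTensorModule.cancelBaseChange R S S A B)
  have h2 : Module.Projective S (A ⊗[R] B) :=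
    Module.Projective.of_equiv (AlgebraTensorModule.cancelBaseChange R S S A B)
  refine { bij := ?_ }
  rw [mulLeftRight_tensor]
  refine (endTensorEnd_bijective.comp ?_).comp (envelopingTensorEquiv R S A B).bijective
  exact (Algebra.TensorProduct.congr (AlgEquiv.ofBijective _ (IsAzumaya.bij (R := S) (A := A)))
    (AlgEquiv.ofBijective _ (IsAzumaya.bij (R := R) (A := B)))).bijective

end TensorAzumaya

lemma isAzumaya_of_tensor (R A Y : Type*) [CommRing R] [Ring A] [Algebra R A] [Ring Y] [Algebra R Y]
    [IsAzumaya R A] [IsAzumaya R (A ⊗[R] Y)] [Module.Finite R Y] [Module.Projective R Y] :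
    IsAzumaya R Y := by
  have := faithfullyFlat_of_isAzumaya R A
  have : FaithfulSMul R Y := by
    rw [faithfulSMul_iff_algebraMap_injective, injective_iff_map_eq_zero]
    intro r hr
    have h : (algebraMap R (A ⊗[R] Y)) r = 0 := by
      rw [Algebra.TensorProduct.algebraMap_apply', hr, TensorProduct.tmul_zero]
    exact (injective_iff_map_eq_zero _).1 (FaithfulSMul.algebraMap_injective R (A ⊗[R] Y)) r h
  have : Module.FaithfullyFlat R (A ⊗[R] Aᵐᵒᵖ) := by
    have : Module.FaithfullyFlat R Aᵐᵒᵖ :=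
      Module.FaithfullyFlat.of_linearEquiv R A (MulOpposite.opLinearEquiv R).symm
    exact faithfullyFlat_tensor
  refine { bij := ?_ }
  have h := IsAzumaya.bij (R := R) (A := A ⊗[R] Y)
  rw [mulLeftRight_tensor] at h
  have h1 : Function.Bijective ((Module.endTensorEndAlgHom (R := R) (S := R) (A := R) (M := A)
      (N := Y)).comp (Algebra.TensorProduct.map (AlgHom.mulLeftRight R A)
      (AlgHom.mulLeftRight R Y))) :=
    (Function.Bijective.of_comp_iff _ (envelopingTensorEquiv R R A Y).bijective).1 h
  have h2 : Function.Bijective (Algebra.TensorProduct.map (AlgHom.mulLeftRight R A)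
      (AlgHom.mulLeftRight R Y)) :=
    (Function.Bijective.of_comp_iff' endTensorEnd_bijective _).1 h1
  have h3 : (Algebra.TensorProduct.map (AlgHom.mulLeftRight R A) (AlgHom.mulLeftRight R Y) :
      (A ⊗[R] Aᵐᵒᵖ) ⊗[R] (Y ⊗[R] Yᵐᵒᵖ) → _) =
      (LinearEquiv.rTensor (Module.End R Y) (LinearEquiv.ofBijective
        (AlgHom.mulLeftRight R A).toLinearMap (IsAzumaya.bij (R := R) (A := A)))) ∘
      (LinearMap.lTensor (A ⊗[R] Aᵐᵒᵖ) (AlgHom.mulLeftRight R Y).toLinearMap) := by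
    ext t
    induction t with
    | zero => simp
    | add a b ha hb => simp only [map_add, ha, hb, Function.comp_apply]
    | tmul p q => rfl
  rw [h3] at h2
  exact (Module.FaithfullyFlat.lTensor_bijective_iff_bijective R (A ⊗[R] Aᵐᵒᵖ)
    (AlgHom.mulLeftRight R Y).toLinearMap).1 ((Function.Bijective.of_comp_iff'
      (LinearEquiv.bijective _) _).1 h2)

end AzuTop

namespace AzuTop

section Centralizer

variable {R A B : Type*} [CommRing R] [Ring A] [Algebra R A] [Ring B] [Algebra R B]

/-- The centralizer of the image of `A`. -/
abbrev imageCentralizer (i : A →ₐ[R] B) : Subalgebra R B :=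
  Subalgebra.centralizer R (Set.range i)

lemma imageCentralizer_comm (i : A →ₐ[R] B) (y : imageCentralizer i) (a : A) :
    i a * y = y * i a := y.2 _ ⟨a, rfl⟩

/-- The multiplication map from `A ⊗ C` to `B`, where `C` is the centralizer of `A`. -/
def centralizerMul (i : A →ₐ[R] B) : A ⊗[R] imageCentralizer i →ₐ[R] B :=
  Algebra.TensorProduct.lift i (imageCentralizer i).val fun a y => imageCentralizer_comm i y a

lemma centralizerMul_tmul (i : A →ₐ[R] B) (a : A) (y : imageCentralizer i) :
    centralizerMul i (a ⊗ₜ y) = i a * y := by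
  exact Algebra.TensorProduct.lift_tmul _ _ _ _ _

lemma bimoduleAction_mul_central (i : A →ₐ[R] B) {y : B} (hy : ∀ a, i a * y = y * i a)
    (t : A ⊗[R] Aᵐᵒᵖ) (a : A) :
    bimoduleAction i t (i a * y) = i (AlgHom.mulLeftRight R A t a) * y := by
  induction t with
  | zero => simp
  | add s t hs ht => simp only [map_add, LinearMap.add_apply, hs, ht, add_mul]
  | tmul p q =>
    rw [bimoduleAction_tmul, AlgHom.mulLeftRight_apply, map_mul, map_mul, mul_assoc (i p),
      mul_assoc (i a), ← hy q.unop]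
    simp only [mul_assoc]

variable [IsAzumaya R A]


/-- The element of the enveloping algebra that acts on `A` as `a ↦ φ a • 1`. -/
def functionalElement (φ : A →ₗ[R] R) : A ⊗[R] Aᵐᵒᵖ :=
  (AlgEquiv.ofBijective _ (IsAzumaya.bij (R := R) (A := A))).symm
    (LinearMap.toSpanSingleton R A 1 ∘ₗ φ)

lemma mulLeftRight_functionalElement (φ : A →ₗ[R] R) :
    AlgHom.mulLeftRight R A (functionalElement φ) = LinearMap.toSpanSingleton R A 1 ∘ₗ φ :=
  (AlgEquiv.ofBijective _ (IsAzumaya.bij (R := R) (A := A))).apply_symm_apply _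

/-- The projection to the centralizer of `A` that belongs to a functional on `A`. -/
def centralProj (i : A →ₐ[R] B) (φ : A →ₗ[R] R) : B →ₗ[R] B :=
  bimoduleAction i (functionalElement φ)

lemma centralProj_mul (i : A →ₐ[R] B) (φ : A →ₗ[R] R) {y : B} (hy : ∀ a, i a * y = y * i a)
    (a : A) : centralProj i φ (i a * y) = φ a • y := by
  rw [centralProj, bimoduleAction_mul_central i hy, mulLeftRight_functionalElement]
  simp

lemma centralProj_commutes (i : A →ₐ[R] B) (φ : A →ₗ[R] R) (a : A) (b : B) :
    i a * centralProj i φ b = centralProj i φ b * i a := by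
  have h : (a ⊗ₜ 1) * functionalElement φ = (1 ⊗ₜ MulOpposite.op a) * functionalElement φ := by
    apply (IsAzumaya.bij (R := R) (A := A)).1
    rw [map_mul, map_mul, mulLeftRight_functionalElement]
    ext x
    simp
  have h2 := congrArg (fun t => bimoduleAction i t b) h
  simpa [centralProj] using h2

lemma sum_mul_centralProj (i : A →ₐ[R] B) {n : ℕ} {x : Fin n → A} {f : Fin n → A →ₗ[R] R}
    (hf : ∀ y, ∑ i, f i y • x i = y) (b : B) : ∑ k, i (x k) * centralProj i (f k) b = b := by
  have h : ∑ k, (x k ⊗ₜ 1) * functionalElement (f k) = (1 : A ⊗[R] Aᵐᵒᵖ) := by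
    apply (IsAzumaya.bij (R := R) (A := A)).1
    simp only [map_sum, map_mul, mulLeftRight_functionalElement, map_one]
    ext y
    simpa using hf y
  have h2 := congrArg (fun t => bimoduleAction i t b) h
  simpa [centralProj] using h2

lemma exists_algebraMap_eq_of_central {z : A} (hz : ∀ a, a * z = z * a) :
    ∃ r, algebraMap R A r = z := by
  obtain ⟨π, hπ⟩ := exists_functional_one R A
  refine ⟨π z, ?_⟩
  have h1 := centralProj_mul (AlgHom.id R A) π hz 1
  have h2 := centralProj_mul (AlgHom.id R A) π (y := 1) (by simp) z
  simp only [AlgHom.id_apply, one_mul, mul_one, hπ, one_smul] at h1 h2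
  rw [Algebra.algebraMap_eq_smul_one, ← h2, h1]

/-- The projection from `B` to the centralizer of `A`. -/
def centralizerProj (i : A →ₐ[R] B) (φ : A →ₗ[R] R) : B →ₗ[R] imageCentralizer i :=
  (centralProj i φ).codRestrict (Subalgebra.toSubmodule (imageCentralizer i)) fun b => by
    rintro _ ⟨a, rfl⟩
    exact centralProj_commutes i φ a b

lemma centralizerProj_coe (i : A →ₐ[R] B) (φ : A →ₗ[R] R) (b : B) :
    (centralizerProj i φ b : B) = centralProj i φ b := rfl

lemma centralizerMul_bijective (i : A →ₐ[R] B) : Function.Bijective (centralizerMul i) := by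
  obtain ⟨n, x, f, hf⟩ := exists_dualBasis R A
  rw [Function.bijective_iff_has_inverse]
  refine ⟨fun b => ∑ k, x k ⊗ₜ centralizerProj i (f k) b, fun t => ?_, fun b => ?_⟩
  · induction t with
    | zero => simp
    | add s t hs ht =>
      simp only [map_add, TensorProduct.tmul_add, Finset.sum_add_distrib] at hs ht ⊢
      rw [hs, ht]
    | tmul a y =>
      have h : ∀ k, centralizerProj i (f k) (i a * y) = f k a • y := fun k =>
        Subtype.ext (centralProj_mul i (f k) (imageCentralizer_comm i y) a :)
      simp only [centralizerMul_tmul, h, TensorProduct.tmul_smul, TensorProduct.smul_tmul',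
        ← TensorProduct.sum_tmul, hf]
  · simp only [map_sum, centralizerMul_tmul]
    simpa only [centralizerProj_coe] using sum_mul_centralProj i hf b

/-- The isomorphism `A ⊗ C ≃ B`, where `C` is the centralizer of `A` in `B`. -/
def centralizerEquiv (i : A →ₐ[R] B) : A ⊗[R] imageCentralizer i ≃ₐ[R] B :=
  AlgEquiv.ofBijective _ (centralizerMul_bijective i)

lemma centralizerEquiv_symm_apply (i : A →ₐ[R] B) (a : A) :
    (centralizerEquiv i).symm (i a) = a ⊗ₜ 1 := by
  rw [AlgEquiv.symm_apply_eq]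
  exact (by simpa using centralizerMul_tmul i a 1 : centralizerMul i (a ⊗ₜ 1) = i a).symm

instance isAzumaya_imageCentralizer [IsAzumaya R B] (i : A →ₐ[R] B) :
    IsAzumaya R (imageCentralizer i) := by
  obtain ⟨π, hπ⟩ := exists_functional_one R A
  have hs : centralizerProj i π ∘ₗ (imageCentralizer i).val.toLinearMap = LinearMap.id := by
    ext y
    have := centralProj_mul i π (imageCentralizer_comm i y) 1
    rw [map_one, one_mul, hπ, one_smul] at this
    rw [LinearMap.comp_apply, centralizerProj_coe]
    exact this
  have : Module.Projective R (imageCentralizer i) := Module.Projective.of_split _ _ hs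
  have : Module.Finite R (imageCentralizer i) :=
    Module.Finite.of_surjective (centralizerProj i π) (LinearMap.surjective_of_comp_eq_id _ _ hs)
  have : IsAzumaya R (A ⊗[R] imageCentralizer i) :=
    IsAzumaya.of_AlgEquiv _ _ _ (centralizerEquiv i).symm
  exact isAzumaya_of_tensor R A _

end Centralizer

end AzuTop

namespace AzuTop

section Rank

lemma isSimpleRing_of_isAzumaya (K A : Type*) [Field K] [Ring A] [Algebra K A] [IsAzumaya K A] :
    IsSimpleRing A := by
  have : Nontrivial A := (FaithfulSMul.algebraMap_injective K A).nontrivial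
  refine ⟨⟨fun I => ?_⟩⟩
  by_cases h : ∃ x ∈ I, x ≠ 0
  · right
    obtain ⟨x, hx, hx0⟩ := h
    have key : ∀ (t : A ⊗[K] Aᵐᵒᵖ), AlgHom.mulLeftRight K A t x ∈ I := by
      intro t
      induction t with
      | zero => simp
      | add s t hs ht => simpa using I.add_mem hs ht
      | tmul a b =>
        rw [AlgHom.mulLeftRight_apply]
        exact I.mul_mem_right _ _ (I.mul_mem_left _ _ hx)
    obtain ⟨f, hf⟩ := Module.Projective.exists_dual_eq_one K hx0
    obtain ⟨t, ht⟩ := (IsAzumaya.bij (R := K) (A := A)).2 (LinearMap.toSpanSingleton K A 1 ∘ₗ f)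
    rw [← TwoSidedIdeal.one_mem_iff]
    have h1 := key t
    rw [ht] at h1
    simpa [hf] using h1
  · left
    push Not at h
    exact le_bot_iff.1 fun x hx => by simpa using h x hx

/-- Over an algebraically closed field Azumaya algebras are matrix algebras. -/
lemma exists_matrix_of_isAlgClosed (R Ω A : Type*) [CommRing R] [Field Ω] [IsAlgClosed Ω]
    [Algebra R Ω] [Ring A] [Algebra R A] [IsAzumaya R A] :
    ∃ n : ℕ+, Nonempty (Ω ⊗[R] A ≃ₐ[Ω] Matrix (Fin n) (Fin n) Ω) := by
  have := isSimpleRing_of_isAzumaya Ω (Ω ⊗[R] A)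
  obtain ⟨n, hn, h⟩ := IsSimpleRing.exists_algEquiv_matrix_of_isAlgClosed Ω (Ω ⊗[R] A)
  exact ⟨⟨n, Nat.pos_of_ne_zero hn.out⟩, h⟩

lemma rankAtStalk_eq_finrank_of_ker (R Ω M : Type*) [CommRing R] [Field Ω] [Algebra R Ω]
    [AddCommGroup M] [Module R M] [Module.Finite R M] [Module.Flat R M] (p : PrimeSpectrum R)
    (hp : RingHom.ker (algebraMap R Ω) = p.asIdeal) :
    Module.rankAtStalk (R := R) M p = Module.finrank Ω (Ω ⊗[R] M) := by
  have h := Module.rankAtStalk_baseChange (R := R) (M := M) (S := Ω) ⊥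
  rw [Module.rankAtStalk_eq_finrank_of_free] at h
  have h2 : PrimeSpectrum.comap (algebraMap R Ω) ⊥ = p := by
    ext1
    rw [← hp]
    rfl
  rw [h2] at h
  exact h.symm

lemma exists_geometric_point {R : Type u} [CommRing R] (p : PrimeSpectrum R) :
    ∃ (Ω : Type u) (_ : Field Ω) (_ : IsAlgClosed Ω) (_ : Algebra R Ω),
      RingHom.ker (algebraMap R Ω) = p.asIdeal ∧
      ∀ x : Ω, ∃ s ∉ p.asIdeal, IsIntegral R (s • x) := by
  refine ⟨AlgebraicClosure p.asIdeal.ResidueField, inferInstance, inferInstance, inferInstance,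
    ?_, fun x => ?_⟩
  · rw [IsScalarTower.algebraMap_eq R p.asIdeal.ResidueField, RingHom.ker_comp_of_injective _
      (algebraMap p.asIdeal.ResidueField _).injective, Ideal.ker_algebraMap_residueField]
  · have h1 : Algebra.IsAlgebraic (R ⧸ p.asIdeal) (AlgebraicClosure p.asIdeal.ResidueField) :=
      (IsFractionRing.comap_isAlgebraic_iff (K := p.asIdeal.ResidueField)).2 inferInstance
    obtain ⟨y, hy, hy2⟩ := (h1.isAlgebraic x).exists_integral_multiple
    obtain ⟨s, rfl⟩ := Ideal.Quotient.mk_surjective y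
    refine ⟨s, fun hs => hy (Ideal.Quotient.eq_zero_iff_mem.2 hs), ?_⟩
    have h2 : IsIntegral R ((Ideal.Quotient.mk p.asIdeal s) • x) := isIntegral_trans _ hy2
    rwa [Algebra.smul_def, ← Ideal.Quotient.algebraMap_eq, ← IsScalarTower.algebraMap_apply,
      ← Algebra.smul_def] at h2

lemma exists_rankAtStalk_eq_sq (R A : Type u) [CommRing R] [Ring A] [Algebra R A] [IsAzumaya R A]
    (p : PrimeSpectrum R) : ∃ n : ℕ+, Module.rankAtStalk (R := R) A p = (n : ℕ) ^ 2 := by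
  obtain ⟨Ω, _, _, _, hp, -⟩ := exists_geometric_point p
  obtain ⟨n, ⟨e⟩⟩ := exists_matrix_of_isAlgClosed R Ω A
  refine ⟨n, ?_⟩
  rw [rankAtStalk_eq_finrank_of_ker R Ω A p hp, e.toLinearEquiv.finrank_eq, Module.finrank_matrix]
  simp [sq]

section Degree

variable {R A B : Type u} [CommRing R] [Ring A] [Algebra R A] [Ring B] [Algebra R B]

lemma HasConstantDegree.congr {n : ℕ+} (h : HasConstantDegree R A n) (e : A ≃ₐ[R] B) :
    HasConstantDegree R B n := fun p => by
  rw [← h p, Module.rankAtStalk_eq_of_equiv e.toLinearEquiv]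

lemma HasConstantDegree.baseChange [IsAzumaya R A] {n : ℕ+} (h : HasConstantDegree R A n)
    (S : Type u) [CommRing S] [Algebra R S] : HasConstantDegree S (S ⊗[R] A) n := fun p => by
  rw [Module.rankAtStalk_baseChange, h]

lemma HasConstantDegree.tensor [IsAzumaya R A] [IsAzumaya R B] {n m : ℕ+}
    (hA : HasConstantDegree R A n) (hB : HasConstantDegree R B m) :
    HasConstantDegree R (A ⊗[R] B) (n * m) := fun p => by
  rw [Module.rankAtStalk_tensorProduct, Pi.mul_apply, hA, hB, PNat.mul_coe, mul_pow]

lemma hasConstantDegree_matrix (R : Type u) [CommRing R] (n : ℕ+) :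
    HasConstantDegree R (Matrix (Fin n) (Fin n) R) n := fun p => by
  have := p.nontrivial
  rw [Module.rankAtStalk_eq_finrank_of_free, Pi.natCast_apply, Module.finrank_matrix]
  simp [sq]

lemma HasConstantDegree.unique [Nontrivial R] {n m : ℕ+}
    (hn : HasConstantDegree R A n) (hm : HasConstantDegree R A m) : n = m := by
  obtain ⟨p⟩ := (inferInstance : Nonempty (PrimeSpectrum R))
  have := (hn p).symm.trans (hm p)
  exact PNat.coe_inj.1 (Nat.pow_left_injective (two_ne_zero) this)

lemma HasConstantDegree.exists_imageCentralizer [Nontrivial R] [IsAzumaya R A] [IsAzumaya R B]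
    {n m : ℕ+} (hA : HasConstantDegree R A n) (hB : HasConstantDegree R B m) (i : A →ₐ[R] B) :
    ∃ k : ℕ+, m = n * k ∧ HasConstantDegree R (imageCentralizer i) k := by
  have key : ∀ p : PrimeSpectrum R, (m : ℕ) ^ 2 = (n : ℕ) ^ 2 *
      Module.rankAtStalk (R := R) (imageCentralizer i) p := fun p => by
    rw [← hA p, ← hB p, ← Module.rankAtStalk_eq_of_equiv (centralizerEquiv i).toLinearEquiv,
      Module.rankAtStalk_tensorProduct, Pi.mul_apply]
  obtain ⟨p⟩ := (inferInstance : Nonempty (PrimeSpectrum R))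
  obtain ⟨k, hk⟩ : (n : ℕ) ∣ m :=
    (Nat.pow_dvd_pow_iff two_ne_zero).1 ⟨_, key p⟩
  have hk0 : 0 < k := Nat.pos_of_ne_zero fun h => by
    rw [h, mul_zero] at hk
    exact m.ne_zero hk
  refine ⟨⟨k, hk0⟩, PNat.coe_inj.1 hk, fun q => ?_⟩
  have := key q
  rw [hk, mul_pow] at this
  exact (Nat.eq_of_mul_eq_mul_left (pow_pos n.pos 2) this).symm

end Degree

end Rank

end AzuTop

namespace AzuTop

section EtalePoints

open Polynomial

variable {R : Type u} [CommRing R]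

lemma exists_etale_factorization {Ω : Type u} [Field Ω] [Algebra R Ω] {p : R[X]} (hp : p.Monic)
    {f g : Polynomial Ω} (hf : f.Monic) (hg : g.Monic) (h : p.map (algebraMap R Ω) = f * g)
    (hfg : IsCoprime f g) :
    ∃ (R' : Type u) (_ : CommRing R') (_ : Algebra R R') (_ : Algebra.Etale R R')
      (φ : R' →ₐ[R] Ω) (f' g' : R'[X]), f'.Monic ∧ g'.Monic ∧
      p.map (algebraMap R R') = f' * g' ∧ IsCoprime f' g' ∧
      f'.map (φ : R' →+* Ω) = f ∧ g'.map (φ : R' →+* Ω) = g := by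
  have hn : p.natDegree = f.natDegree + g.natDegree := by
    rw [← hf.natDegree_mul hg, ← h, hp.natDegree_map]
  let p' : MonicDegreeEq R p.natDegree := .mk p hp rfl
  let e := fun (S : Type u) [CommRing S] [Algebra R S] =>
    UniversalCoprimeFactorizationRing.homEquiv S f.natDegree g.natDegree hn p'
  let φ := (e Ω).symm ⟨(.mk f hf rfl, .mk g hg rfl), h.symm, hfg⟩
  let q := e _ (AlgHom.id R _)
  refine ⟨_, inferInstance, inferInstance, inferInstance, φ, q.1.1.1, q.1.2.1, q.1.1.monic,
    q.1.2.monic, q.2.1.symm, q.2.2, ?_, ?_⟩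
  · have h1 := UniversalCoprimeFactorizationRing.homEquiv_comp_fst _ f.natDegree g.natDegree hn p'
      (AlgHom.id R _) φ
    rw [AlgHom.comp_id] at h1
    have h2 := (e Ω).apply_symm_apply ⟨(.mk f hf rfl, .mk g hg rfl), h.symm, hfg⟩
    have h3 := congrArg (fun x => x.1.1.1) h2
    exact (congrArg Subtype.val h1).symm.trans h3
  · have h1 := UniversalCoprimeFactorizationRing.homEquiv_comp_snd _ f.natDegree g.natDegree hn p'
      (AlgHom.id R _) φ
    rw [AlgHom.comp_id] at h1
    have h2 := (e Ω).apply_symm_apply ⟨(.mk f hf rfl, .mk g hg rfl), h.symm, hfg⟩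
    have h3 := congrArg (fun x => x.1.2.1) h2
    exact (congrArg Subtype.val h1).symm.trans h3

lemma exists_etale_of_isIntegral (hR : ∀ m : ℕ, m ≠ 0 → IsUnit (m : R)) {Ω : Type u} [Field Ω]
    [Algebra R Ω] {x : Ω} (hx : IsIntegral R x) :
    ∃ (R' : Type u) (_ : CommRing R') (_ : Algebra R R') (_ : Algebra.Etale R R')
      (φ : R' →ₐ[R] Ω), x ∈ φ.range := by
  obtain ⟨p, hp, hpx⟩ := hx
  have hp0 : p.map (algebraMap R Ω) ≠ 0 := (hp.map _).ne_zero
  obtain ⟨g, hg, hxg⟩ := exists_eq_pow_rootMultiplicity_mul_and_not_dvd _ hp0 x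
  set m := rootMultiplicity x (p.map (algebraMap R Ω)) with hm
  have hm0 : 0 < m := (rootMultiplicity_pos hp0).2 (by rwa [IsRoot, Polynomial.eval_map])
  have hf : ((X - C x) ^ m).Monic := (monic_X_sub_C x).pow m
  have hgm : g.Monic := hf.of_mul_monic_left (hg ▸ hp.map _)
  have hco : IsCoprime ((X - C x) ^ m) g :=
    IsCoprime.pow_left (((irreducible_X_sub_C x).coprime_iff_not_dvd).2 hxg)
  obtain ⟨R', _, _, _, φ, f', g', hf', -, -, -, hφ, -⟩ :=
    exists_etale_factorization hp hf hgm hg hco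
  refine ⟨R', inferInstance, inferInstance, inferInstance, φ, ?_⟩
  have h1 : ((X - C x) ^ m).coeff (m - 1) = -(m * x) := by
    have h := (monic_X_sub_C x).nextCoeff_pow m
    rw [nextCoeff_of_natDegree_pos (by rw [natDegree_pow, natDegree_X_sub_C]; omega), natDegree_pow,
      natDegree_X_sub_C, mul_one, nextCoeff_X_sub_C] at h
    rw [h]
    simp
  have h2 : (m : Ω) * x ∈ φ.range := by
    rw [← neg_neg ((m : Ω) * x), ← h1, ← hφ, coeff_map]
    exact neg_mem ⟨_, rfl⟩
  obtain ⟨u, hu⟩ := hR m hm0.ne'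
  have h3 := φ.range.smul_mem h2 (↑u⁻¹ : R)
  rwa [Algebra.smul_def, ← mul_assoc, ← map_natCast (algebraMap R Ω) m, ← map_mul, ← hu,
    Units.inv_mul, map_one, one_mul] at h3

lemma exists_etale_of_isIntegral_smul (hR : ∀ m : ℕ, m ≠ 0 → IsUnit (m : R)) {Ω : Type u} [Field Ω]
    [Algebra R Ω] {x : Ω} {s : R} (hs : algebraMap R Ω s ≠ 0) (hx : IsIntegral R (s • x)) :
    ∃ (R' : Type u) (_ : CommRing R') (_ : Algebra R R') (_ : Algebra.Etale R R')
      (φ : R' →ₐ[R] Ω), x ∈ φ.range := by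
  obtain ⟨R', _, _, _, φ, y, hy⟩ := exists_etale_of_isIntegral hR hx
  have hu : IsUnit (φ (algebraMap R R' s)) := by
    rw [φ.commutes]
    exact hs.isUnit
  have : Algebra.Etale R' (Localization.Away (algebraMap R R' s)) :=
    Algebra.Etale.of_isLocalizationAway (algebraMap R R' s)
  have : Algebra.Etale R (Localization.Away (algebraMap R R' s)) := Algebra.Etale.comp R R' _
  let ψ : Localization.Away (algebraMap R R' s) →ₐ[R] Ω :=
    IsLocalization.Away.liftAlgHom (f := φ) (algebraMap R R' s) hu
  have hψ : ∀ z, ψ (algebraMap R' _ z) = φ z := fun z => IsLocalization.Away.lift_eq _ hu z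
  refine ⟨_, inferInstance, inferInstance, this, ψ,
    IsLocalization.Away.invSelf (algebraMap R R' s) * algebraMap R' _ y, ?_⟩
  have h1 := IsLocalization.Away.mul_invSelf (S := Localization.Away (algebraMap R R' s))
    (algebraMap R R' s)
  have h2 := congrArg ψ h1
  rw [map_mul, hψ, map_one, φ.commutes] at h2
  have hy' : φ y = s • x := hy
  change ψ _ = x
  rw [map_mul, hψ, hy', Algebra.smul_def, ← mul_assoc, mul_comm (ψ _), h2, one_mul]

/-- Two étale neighbourhoods of a geometric point have a common refinement. -/
lemma exists_etale_common {Ω : Type u} [Field Ω] [Algebra R Ω] (R₁ R₂ : Type u) [CommRing R₁]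
    [CommRing R₂] [Algebra R R₁] [Algebra R R₂] [Algebra.Etale R R₁] [Algebra.Etale R R₂]
    (φ₁ : R₁ →ₐ[R] Ω) (φ₂ : R₂ →ₐ[R] Ω) :
    ∃ (R' : Type u) (_ : CommRing R') (_ : Algebra R R') (_ : Algebra.Etale R R')
      (φ : R' →ₐ[R] Ω) (i₁ : R₁ →ₐ[R] R') (i₂ : R₂ →ₐ[R] R'),
      φ.comp i₁ = φ₁ ∧ φ.comp i₂ = φ₂ := by
  have : Algebra.Etale R₁ (R₁ ⊗[R] R₂) := inferInstance
  refine ⟨R₁ ⊗[R] R₂, inferInstance, inferInstance, Algebra.Etale.comp R R₁ _,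
    Algebra.TensorProduct.productMap φ₁ φ₂, Algebra.TensorProduct.includeLeft,
    Algebra.TensorProduct.includeRight, by simp, by simp⟩

lemma exists_etale_of_tensor (hR : ∀ m : ℕ, m ≠ 0 → IsUnit (m : R)) {Ω : Type u} [Field Ω]
    [Algebra R Ω] (hΩ : ∀ x : Ω, ∃ s : R, algebraMap R Ω s ≠ 0 ∧ IsIntegral R (s • x))
    {Y : Type u} [Ring Y] [Algebra R Y] (t : Ω ⊗[R] Y) :
    ∃ (R' : Type u) (_ : CommRing R') (_ : Algebra R R') (_ : Algebra.Etale R R')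
      (φ : R' →ₐ[R] Ω) (t' : R' ⊗[R] Y), Algebra.TensorProduct.map φ (AlgHom.id R Y) t' = t := by
  obtain ⟨s₀, hs₀, hi₀⟩ := hΩ 0
  induction t with
  | zero =>
    obtain ⟨R', _, _, _, φ, -⟩ := exists_etale_of_isIntegral_smul hR hs₀ hi₀
    exact ⟨R', inferInstance, inferInstance, inferInstance, φ, 0, map_zero _⟩
  | tmul x y =>
    obtain ⟨s, hs, hi⟩ := hΩ x
    obtain ⟨R', _, _, _, φ, x', hx'⟩ := exists_etale_of_isIntegral_smul hR hs hi
    refine ⟨R', inferInstance, inferInstance, inferInstance, φ, x' ⊗ₜ y, ?_⟩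
    rw [Algebra.TensorProduct.map_tmul]
    exact congrArg (· ⊗ₜ[R] y) hx'
  | add a b ha hb =>
    obtain ⟨R₁, _, _, _, φ₁, t₁, h₁⟩ := ha
    obtain ⟨R₂, _, _, _, φ₂, t₂, h₂⟩ := hb
    obtain ⟨R', _, _, _, φ, i₁, i₂, e₁, e₂⟩ := exists_etale_common R₁ R₂ φ₁ φ₂
    refine ⟨R', inferInstance, inferInstance, inferInstance, φ,
      Algebra.TensorProduct.map i₁ (AlgHom.id R Y) t₁ +
      Algebra.TensorProduct.map i₂ (AlgHom.id R Y) t₂, ?_⟩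
    rw [map_add, ← AlgHom.comp_apply, ← AlgHom.comp_apply, ← Algebra.TensorProduct.map_comp,
      ← Algebra.TensorProduct.map_comp, e₁, e₂, AlgHom.comp_id, h₁, h₂]

end EtalePoints

end AzuTop

namespace AzuTop

section Splitting

open Polynomial

variable {R : Type u} [CommRing R]

lemma aeval_eq_of_isIdempotentElem {Ω Z : Type*} [Field Ω] [Ring Z] [Algebra Ω Z] {e : Z}
    (he : IsIdempotentElem e) {P : Polynomial Ω} (h0 : P.eval 0 = 0) (h1 : P.eval 1 = 1) :
    aeval e P = e := by
  have hd : (X : Polynomial Ω) * (X - C 1) ∣ P - X := by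
    refine IsCoprime.mul_dvd ?_ ?_ ?_
    · exact ⟨1, -1, by simp⟩
    · rw [X_dvd_iff, coeff_zero_eq_eval_zero]
      simp [h0]
    · rw [dvd_iff_isRoot]
      simp [h1]
  obtain ⟨q, hq⟩ := hd
  have h := congrArg (aeval e) hq
  rw [map_sub, map_mul, map_mul, map_sub, aeval_X, aeval_C, map_one, mul_sub, he.eq, mul_one,
    sub_self, zero_mul, sub_eq_zero] at h
  exact h

lemma exists_etale_idempotent {Ω : Type u} [Field Ω] [Algebra R Ω] {Y : Type u} [Ring Y]
    [Algebra R Y] [Module.Finite R Y] (y : Y)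
    (hy : IsIdempotentElem (1 ⊗ₜ y : Ω ⊗[R] Y)) :
    ∃ (R' : Type u) (_ : CommRing R') (_ : Algebra R R') (_ : Algebra.Etale R R')
      (φ : R' →ₐ[R] Ω) (e : R' ⊗[R] Y), IsIdempotentElem e ∧
      Algebra.TensorProduct.map φ (AlgHom.id R Y) e = 1 ⊗ₜ y := by
  have := (algebraMap R Ω).domain_nontrivial
  obtain ⟨f, hf, hfy⟩ := IsIntegral.of_finite R y
  have hF : (X * (X - C 1) * f).Monic := (monic_X.mul (monic_X_sub_C 1)).mul hf
  have hFy : aeval y (X * (X - C 1) * f) = 0 := by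
    rw [map_mul, aeval_def _ f, hfy, mul_zero]
  set F := X * (X - C 1) * f with hFdef
  have hFΩ : F.map (algebraMap R Ω) ≠ 0 := (hF.map _).ne_zero
  obtain ⟨g, hg, h1g⟩ := exists_eq_pow_rootMultiplicity_mul_and_not_dvd _ hFΩ 1
  set m := rootMultiplicity 1 (F.map (algebraMap R Ω)) with hm
  have hm0 : 0 < m := (rootMultiplicity_pos hFΩ).2 (by simp [F])
  have hX : ((X - C (1 : Ω)) ^ m).Monic := (monic_X_sub_C 1).pow m
  have hgm : g.Monic := hX.of_mul_monic_left (hg ▸ hF.map _)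
  have hco : IsCoprime ((X - C (1 : Ω)) ^ m) g :=
    IsCoprime.pow_left (((irreducible_X_sub_C 1).coprime_iff_not_dvd).2 h1g)
  obtain ⟨R', _, _, _, φ, f', g', -, -, hfg, ⟨a, b, hab⟩, hφf, hφg⟩ :=
    exists_etale_factorization hF hX hgm hg hco
  refine ⟨R', inferInstance, inferInstance, inferInstance, φ, aeval (1 ⊗ₜ y) (b * g'), ?_, ?_⟩
  · have h0 : aeval (1 ⊗ₜ y : R' ⊗[R] Y) (F.map (algebraMap R R')) = 0 := by
      have := congrArg (Algebra.TensorProduct.includeRight : Y →ₐ[R] R' ⊗[R] Y) hFy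
      rw [← aeval_algHom_apply, map_zero] at this
      rwa [aeval_map_algebraMap]
    have h1 : (b * g') * (b * g') = b * g' - a * b * (F.map (algebraMap R R')) := by
      rw [hfg]
      linear_combination (b * g') * hab
    rw [IsIdempotentElem, ← map_mul, h1, map_sub, map_mul _ (a * b), h0, mul_zero, sub_zero]
  · have hP : Algebra.TensorProduct.map φ (AlgHom.id R Y) (aeval (1 ⊗ₜ y) (b * g')) =
        aeval (1 ⊗ₜ y : Ω ⊗[R] Y) ((b * g').map (φ : R' →+* Ω)) := by
      rw [aeval_def, aeval_def, eval₂_map]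
      have := hom_eval₂ (b * g') (algebraMap R' (R' ⊗[R] Y))
        (Algebra.TensorProduct.map φ (AlgHom.id R Y) : R' ⊗[R] Y →+* Ω ⊗[R] Y) (1 ⊗ₜ y)
      refine this.trans ?_
      congr 1
      simp
    rw [hP]
    apply aeval_eq_of_isIdempotentElem hy
    · have := congrArg (eval 0) hg
      simp only [hFdef, Polynomial.map_mul, map_X, eval_mul, eval_X, zero_mul, eval_pow, eval_sub,
        eval_C, zero_sub] at this
      have h0 : eval 0 g = 0 := (mul_eq_zero.1 this.symm).resolve_left (by simp)
      rw [Polynomial.map_mul, eval_mul, hφg, h0, mul_zero]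
    · have := congrArg (fun q => eval 1 (q.map (φ : R' →+* Ω))) hab
      simpa [hφf, hφg, hm0.ne'] using this

/-- The left ideal generated by an idempotent. -/
abbrev leftIdeal (E : Type*) {Z : Type*} [CommRing E] [Ring Z] [Algebra E Z] (e : Z) :
    Submodule E Z := LinearMap.range (LinearMap.mulRight E e)

/-- The action by left multiplication on a left ideal. -/
def leftIdealAction (E : Type*) {Z : Type*} [CommRing E] [Ring Z] [Algebra E Z] (e : Z) :
    Z →ₐ[E] Module.End E (leftIdeal E e) :=
  AlgHom.ofLinearMap
    { toFun := fun z => (LinearMap.mulLeft E z).restrict (by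
        rintro _ ⟨w, rfl⟩
        exact ⟨z * w, by simp [mul_assoc]⟩)
      map_add' := fun a b => by ext; simp [add_mul]
      map_smul' := fun r a => by ext; simp }
    (by ext; simp) (fun a b => by ext; simp)

lemma leftIdeal_split (E : Type*) {Z : Type*} [CommRing E] [Ring Z] [Algebra E Z] {e : Z}
    (he : IsIdempotentElem e) :
    (LinearMap.mulRight E e).rangeRestrict ∘ₗ (leftIdeal E e).subtype = LinearMap.id := by
  ext ⟨_, w, rfl⟩
  simp [mul_assoc, he.eq]

lemma finrank_tensor_leftIdeal {E Ω Z W : Type*} [CommRing E] [Field Ω] [Algebra E Ω] [Ring Z]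
    [Algebra E Z] [Ring W] [Algebra Ω W] (Θ : Ω ⊗[E] Z ≃ₐ[Ω] W) {e : Z} (he : IsIdempotentElem e) :
    Module.finrank Ω (Ω ⊗[E] leftIdeal E e) =
      Module.finrank Ω (leftIdeal Ω (Θ (1 ⊗ₜ e))) := by
  have hs := leftIdeal_split E he
  set ι := (leftIdeal E e).subtype
  set ρ := (LinearMap.mulRight E e).rangeRestrict
  have hs' : ρ.baseChange Ω ∘ₗ ι.baseChange Ω = LinearMap.id := by
    rw [← LinearMap.baseChange_comp, hs, LinearMap.baseChange_id]
  have hinj : Function.Injective (Θ.toLinearMap ∘ₗ ι.baseChange Ω) :=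
    Θ.injective.comp (LinearMap.injective_of_comp_eq_id _ _ hs')
  rw [← LinearMap.finrank_range_of_inj hinj]
  suffices h : LinearMap.range (Θ.toLinearMap ∘ₗ ι.baseChange Ω) = leftIdeal Ω (Θ (1 ⊗ₜ e)) by
    rw [h]
  have hsurj : Function.Surjective (ρ.baseChange Ω ∘ₗ Θ.symm.toLinearMap) :=
    (LinearMap.surjective_of_comp_eq_id _ _ hs').comp Θ.symm.surjective
  rw [← LinearMap.range_comp_of_range_eq_top (Θ.toLinearMap ∘ₗ ι.baseChange Ω)
    (LinearMap.range_eq_top.2 hsurj)]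
  congr 1
  have h1 : ι.baseChange Ω ∘ₗ ρ.baseChange Ω = LinearMap.mulRight Ω (1 ⊗ₜ e) := by
    rw [← LinearMap.baseChange_comp]
    ext z
    simp [ι, ρ]
  ext w
  have h2 := congrArg Θ (LinearMap.congr_fun h1 (Θ.symm w))
  simpa using h2

lemma finrank_leftIdeal_single (Ω : Type*) [Field Ω] (n : ℕ+) :
    Module.finrank Ω (leftIdeal Ω (Matrix.single (⟨0, n.pos⟩ : Fin n) (⟨0, n.pos⟩ : Fin n) (1 : Ω))) = n := by
  set z : Fin n := ⟨0, n.pos⟩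
  let L : (Fin n → Ω) →ₗ[Ω] Matrix (Fin n) (Fin n) Ω :=
    { toFun := fun v => Matrix.of fun i j => if j = z then v i else 0
      map_add' := fun v w => by ext i j; by_cases h : j = z <;> simp [h]
      map_smul' := fun r v => by ext i j; by_cases h : j = z <;> simp [h] }
  have hL : Function.Injective L := fun v w h => by
    ext i
    simpa [L] using congrFun (congrFun h i) z
  have : leftIdeal Ω (Matrix.single z z (1 : Ω)) = LinearMap.range L := by
    apply le_antisymm
    · rintro _ ⟨w, rfl⟩
      refine ⟨fun i => w i z, ?_⟩
      ext i j
      by_cases h : j = z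
      · subst h; simp [L]
      · simp [L, h, Matrix.mul_apply, Ne.symm h]
    · rintro _ ⟨v, rfl⟩
      refine ⟨L v, ?_⟩
      ext i j
      by_cases h : j = z
      · subst h; simp [L]
      · simp [L, h, Matrix.mul_apply, Ne.symm h]
  rw [this, LinearMap.finrank_range_of_inj hL]
  simp

end Splitting

end AzuTop

namespace AzuTop

section Splitting

variable {R : Type u} [CommRing R]

/-- Base change in two steps is base change in one step. -/
def cancelBaseChangeAlg (R S T A : Type*) [CommRing R] [CommRing S] [CommRing T] [Algebra R S]
    [Algebra R T] [Algebra S T] [IsScalarTower R S T] [Ring A] [Algebra R A] :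
    T ⊗[S] (S ⊗[R] A) ≃ₐ[T] T ⊗[R] A :=
  AlgEquiv.ofLinearEquiv (AlgebraTensorModule.cancelBaseChange R S T T A)
    (by simp [Algebra.TensorProduct.one_def]) (LinearMap.map_mul_iff _ |>.mpr <| by ext; simp)

lemma cancelBaseChangeAlg_tmul (R S T A : Type*) [CommRing R] [CommRing S] [CommRing T]
    [Algebra R S] [Algebra R T] [Algebra S T] [IsScalarTower R S T] [Ring A] [Algebra R A] (t : T)
    (s : S) (a : A) : cancelBaseChangeAlg R S T A (t ⊗ₜ (s ⊗ₜ a)) = (s • t) ⊗ₜ a :=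
  AlgebraTensorModule.cancelBaseChange_tmul _ _ _ _ _ _

lemma exists_free_away (M : Type*) [AddCommGroup M] [Module R M] [Module.Finite R M]
    [Module.Projective R M] (p : PrimeSpectrum R) :
    ∃ a ∉ p.asIdeal, Module.Free (Localization (Submonoid.powers a)) (LocalizedModule.Away a M) ∧
      Module.finrank (Localization (Submonoid.powers a)) (LocalizedModule.Away a M) =
        Module.rankAtStalk (R := R) M p := by
  have : Module.FinitePresentation R M := Module.finitePresentation_of_projective R M
  have : Module.Free (Localization.AtPrime p.asIdeal)
      (LocalizedModule p.asIdeal.primeCompl M) := Module.free_of_flat_of_isLocalRing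
  exact Module.FinitePresentation.exists_free_localizedModule_powers
    p.asIdeal.primeCompl (LocalizedModule.mkLinearMap p.asIdeal.primeCompl M)
    (Localization.AtPrime p.asIdeal)

/-- A projective left ideal of rank `k` at a geometric point gives, near that point, an action on
a free module of rank `k`. -/
lemma exists_away_matrix_hom {Ω : Type u} [Field Ω] [Algebra R Ω] {Z : Type u} [Ring Z]
    [Algebra R Z] [Module.Finite R Z] [Module.Projective R Z] {e : Z} (he : IsIdempotentElem e)
    {k : ℕ} (hk : Module.finrank Ω (Ω ⊗[R] leftIdeal R e) = k) :
    ∃ (R' : Type u) (_ : CommRing R') (_ : Algebra R R') (_ : Algebra.Etale R R')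
      (_ : R' →ₐ[R] Ω), Nonempty (Z →ₐ[R] Matrix (Fin k) (Fin k) R') := by
  have hs := leftIdeal_split R he
  have : Module.Projective R (leftIdeal R e) := Module.Projective.of_split _ _ hs
  have : Module.Finite R (leftIdeal R e) := Module.Finite.of_surjective _
    (LinearMap.mulRight R e).surjective_rangeRestrict
  obtain ⟨p, hp⟩ : ∃ p : PrimeSpectrum R, RingHom.ker (algebraMap R Ω) = p.asIdeal :=
    ⟨⟨_, RingHom.ker_isPrime _⟩, rfl⟩
  have hr := rankAtStalk_eq_finrank_of_ker R Ω (leftIdeal R e) p hp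
  rw [hk] at hr
  obtain ⟨a, ha, hfree, hrank'⟩ := exists_free_away (leftIdeal R e) p
  rw [hr] at hrank'
  have hu : IsUnit (Algebra.ofId R Ω a) := IsUnit.mk0 _ fun h => ha (hp ▸ h)
  let E := Localization.Away a
  have : Nontrivial E := (IsLocalization.Away.liftAlgHom (S := E) a hu : E →ₐ[R] Ω).toRingHom.domain_nontrivial
  have het : Algebra.Etale R E := Algebra.Etale.of_isLocalizationAway a
  let eM := LocalizedModule.equivTensorProduct (Submonoid.powers a) (leftIdeal R e)
  have : Module.Free E (E ⊗[R] leftIdeal R e) := Module.Free.of_equiv eM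
  have hrk : Module.finrank E (E ⊗[R] leftIdeal R e) = k := eM.finrank_eq.symm.trans hrank'
  let b := Module.finBasisOfFinrankEq E (E ⊗[R] leftIdeal R e) hrk
  refine ⟨E, inferInstance, inferInstance, het, IsLocalization.Away.liftAlgHom a hu, ⟨?_⟩⟩
  exact (((algEquivMatrix b).toAlgHom.restrictScalars R).comp
    (Module.End.baseChangeHom R E (leftIdeal R e))).comp (leftIdealAction R e)

/-- Azumaya algebras are split by étale neighbourhoods of geometric points. -/
lemma exists_etale_matrix_hom (hR : ∀ m : ℕ, m ≠ 0 → IsUnit (m : R)) {Ω : Type u} [Field Ω]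
    [IsAlgClosed Ω] [Algebra R Ω]
    (hΩ : ∀ x : Ω, ∃ s : R, algebraMap R Ω s ≠ 0 ∧ IsIntegral R (s • x)) {Y : Type u} [Ring Y]
    [Algebra R Y] [IsAzumaya R Y] {k : ℕ+} (hk : HasConstantDegree R Y k) :
    ∃ (R' : Type u) (_ : CommRing R') (_ : Algebra R R') (_ : Algebra.Etale R R')
      (_ : R' →ₐ[R] Ω), Nonempty (Y →ₐ[R] Matrix (Fin k) (Fin k) R') := by
  obtain ⟨n, ⟨θ⟩⟩ := exists_matrix_of_isAlgClosed R Ω Y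
  obtain rfl : n = k := (hasConstantDegree_matrix Ω n).unique ((hk.baseChange Ω).congr θ)
  set z : Fin n := ⟨0, n.pos⟩
  have hz : IsIdempotentElem (Matrix.single z z (1 : Ω)) := by simp [IsIdempotentElem]
  obtain ⟨R₁, _, _, _, φ₁, t, ht⟩ := exists_etale_of_tensor hR hΩ (θ.symm (Matrix.single z z 1))
  let : Algebra R₁ Ω := φ₁.toRingHom.toAlgebra
  have : IsScalarTower R R₁ Ω := IsScalarTower.of_algebraMap_eq fun r => (φ₁.commutes r).symm
  let θ₁ : Ω ⊗[R₁] (R₁ ⊗[R] Y) ≃ₐ[Ω] Ω ⊗[R] Y := cancelBaseChangeAlg R R₁ Ω Y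
  have hθ₁ : ∀ w : R₁ ⊗[R] Y, θ₁ (1 ⊗ₜ w) = Algebra.TensorProduct.map φ₁ (AlgHom.id R Y) w := by
    intro w
    induction w with
    | zero => simp
    | add a b ha hb => rw [TensorProduct.tmul_add, map_add, map_add, ha, hb]
    | tmul r y =>
      rw [Algebra.TensorProduct.map_tmul, cancelBaseChangeAlg_tmul,
        Algebra.smul_def, mul_one]
      rfl
  have hidem : IsIdempotentElem (1 ⊗ₜ t : Ω ⊗[R₁] (R₁ ⊗[R] Y)) := by
    apply (θ₁.trans θ).injective
    rw [map_mul]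
    simp [hθ₁, ht]
  obtain ⟨R₂, _, _, _, φ₂, e, he, heφ⟩ := exists_etale_idempotent t hidem
  let : Algebra R₂ Ω := φ₂.toRingHom.toAlgebra
  have : IsScalarTower R₁ R₂ Ω := IsScalarTower.of_algebraMap_eq fun r => (φ₂.commutes r).symm
  let θ₂ : Ω ⊗[R₂] (R₂ ⊗[R₁] (R₁ ⊗[R] Y)) ≃ₐ[Ω] Ω ⊗[R₁] (R₁ ⊗[R] Y) :=
    cancelBaseChangeAlg R₁ R₂ Ω (R₁ ⊗[R] Y)
  have hθ₂ : ∀ w : R₂ ⊗[R₁] (R₁ ⊗[R] Y),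
      θ₂ (1 ⊗ₜ w) = Algebra.TensorProduct.map φ₂ (AlgHom.id R₁ (R₁ ⊗[R] Y)) w := by
    intro w
    induction w with
    | zero => simp
    | add a b ha hb => rw [TensorProduct.tmul_add, map_add, map_add, ha, hb]
    | tmul r y =>
      rw [Algebra.TensorProduct.map_tmul, cancelBaseChangeAlg_tmul,
        Algebra.smul_def, mul_one]
      rfl
  have hΘ : ((θ₂.trans θ₁).trans θ) (1 ⊗ₜ e) = Matrix.single z z 1 := by
    simp only [AlgEquiv.trans_apply, hθ₂, heφ, hθ₁, ht, AlgEquiv.apply_symm_apply]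
  have hfr := finrank_tensor_leftIdeal ((θ₂.trans θ₁).trans θ) he
  rw [hΘ, finrank_leftIdeal_single] at hfr
  obtain ⟨R₃, _, _, _, φ₃, ⟨f⟩⟩ := exists_away_matrix_hom he hfr
  let : Algebra R₁ R₃ := ((algebraMap R₂ R₃).comp (algebraMap R₁ R₂)).toAlgebra
  have : IsScalarTower R₁ R₂ R₃ := IsScalarTower.of_algebraMap_eq fun r => rfl
  let : Algebra R R₃ := ((algebraMap R₁ R₃).comp (algebraMap R R₁)).toAlgebra
  have : IsScalarTower R R₁ R₃ := IsScalarTower.of_algebraMap_eq fun r => rfl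
  have : Algebra.Etale R₁ R₃ := Algebra.Etale.comp R₁ R₂ R₃
  refine ⟨R₃, inferInstance, inferInstance, Algebra.Etale.comp R R₁ R₃,
    ((φ₃.restrictScalars R₁).restrictScalars R), ⟨?_⟩⟩
  exact (((f.restrictScalars R₁).comp Algebra.TensorProduct.includeRight).restrictScalars R).comp
    Algebra.TensorProduct.includeRight

end Splitting

end AzuTop

namespace AzuTop

section Amalgam

variable {R A A' B : Type u} [CommRing R] [Ring A] [Algebra R A] [Ring A'] [Algebra R A'] [Ring B]
  [Algebra R B] [IsAzumaya R A] [IsAzumaya R A'] [IsAzumaya R B]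

/-- Two Azumaya algebras over `A` embed into a common one. -/
lemma exists_amalgam [Nontrivial R] {n n' m : ℕ+} (hA : HasConstantDegree R A n)
    (hA' : HasConstantDegree R A' n') (hB : HasConstantDegree R B m) (i : A →ₐ[R] A')
    (j : A →ₐ[R] B) :
    ∃ k : ℕ+, n' = n * k ∧ ∃ (B' : Type u) (_ : Ring B') (_ : Algebra R B') (_ : IsAzumaya R B')
      (f : A' →ₐ[R] B') (g : B →ₐ[R] B'), HasConstantDegree R B' (m * k) ∧
      f.comp i = g.comp j := by
  obtain ⟨k, hk, hC⟩ := hA.exists_imageCentralizer hA' i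
  refine ⟨k, hk, B ⊗[R] imageCentralizer i, inferInstance, inferInstance, inferInstance,
    (Algebra.TensorProduct.map j (AlgHom.id R _)).comp (centralizerEquiv i).symm.toAlgHom,
    Algebra.TensorProduct.includeLeft, hB.tensor hC, ?_⟩
  ext a
  have := congrArg (Algebra.TensorProduct.map j (AlgHom.id R _)) (centralizerEquiv_symm_apply i a)
  simpa using this

/-- The block diagonal embedding of matrix algebras. -/
lemma exists_matrix_hom (S : Type*) [CommRing S] (k l : ℕ) :
    Nonempty (Matrix (Fin k) (Fin k) S →ₐ[S] Matrix (Fin (k * l)) (Fin (k * l)) S) := by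
  let f : Matrix (Fin k) (Fin k) S →ₐ[S] Matrix (Fin k × Fin l) (Fin k × Fin l) S :=
    { (Matrix.blockDiagonalRingHom (Fin k) (Fin l) S).comp
        (RingHom.pi fun _ => RingHom.id (Matrix (Fin k) (Fin k) S)) with
      commutes' := fun r => by
        ext ⟨a, b⟩ ⟨c, d⟩
        by_cases h : a = c <;> by_cases h' : b = d <;>
          simp [Matrix.blockDiagonal_apply, Matrix.algebraMap_matrix_apply, RingHom.pi, h, h'] }
  exact ⟨(Matrix.reindexAlgEquiv S S finProdFinEquiv).toAlgHom.comp f⟩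

lemma hasConstantDegree_tensor_of_isScalarTower {S M : Type u} [CommRing S] [Algebra R S]
    [Ring M] [Algebra R M] [Algebra S M] [IsScalarTower R S M] [IsAzumaya S M] {m n : ℕ+}
    (hM : HasConstantDegree S M m) (hA : HasConstantDegree R A n) :
    HasConstantDegree S (M ⊗[R] A) (m * n) := fun p => by
  rw [← hM.tensor (hA.baseChange S) p]
  exact congrFun (Module.rankAtStalk_eq_of_equiv
    (AlgebraTensorModule.cancelBaseChange R S S M A).symm) p

/-- Étale locally, two Azumaya algebras over `A` embed into a common one of the degree of one of
them, if this degree is a multiple of the degree of the other. -/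
lemma exists_etale_amalgam (hR : ∀ m : ℕ, m ≠ 0 → IsUnit (m : R)) (p : PrimeSpectrum R)
    {n n' m : ℕ+} (hA : HasConstantDegree R A n)
    (hA' : HasConstantDegree R A' n') (hB : HasConstantDegree R B m) (h : n' ∣ m) (i : A →ₐ[R] A')
    (j : A →ₐ[R] B) :
    ∃ (S : Type u) (_ : CommRing S) (_ : Algebra R S) (_ : Algebra.Etale R S)
      (q : PrimeSpectrum S) (B' : Type u) (_ : Ring B') (_ : Algebra R B') (_ : Algebra S B')
      (_ : IsScalarTower R S B') (_ : IsAzumaya S B')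
      (f : A' →ₐ[R] B') (g : B →ₐ[R] B'), PrimeSpectrum.comap (algebraMap R S) q = p ∧
      HasConstantDegree S B' m ∧ f.comp i = g.comp j := by
  have := p.nontrivial
  obtain ⟨k, rfl, hY⟩ := hA.exists_imageCentralizer hA' i
  obtain ⟨x, rfl, hX⟩ := hA.exists_imageCentralizer hB j
  obtain ⟨l, hl⟩ := h
  obtain rfl : x = k * l := by
    rw [mul_assoc] at hl
    exact mul_left_cancel hl
  obtain ⟨Ω, _, _, _, hp, hΩ⟩ := exists_geometric_point p
  have hΩ' : ∀ x : Ω, ∃ s : R, algebraMap R Ω s ≠ 0 ∧ IsIntegral R (s • x) := fun x => by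
    obtain ⟨s, hs, hi⟩ := hΩ x
    exact ⟨s, fun h => hs (hp ▸ h), hi⟩
  obtain ⟨R₁, _, _, _, φ₁, ⟨f₁⟩⟩ := exists_etale_matrix_hom hR hΩ' hY
  obtain ⟨R₂, _, _, _, φ₂, ⟨f₂⟩⟩ := exists_etale_matrix_hom hR hΩ' hX
  obtain ⟨S, _, _, _, φ, i₁, i₂, -, -⟩ := exists_etale_common R₁ R₂ φ₁ φ₂
  obtain ⟨b⟩ := exists_matrix_hom S k l
  let M := Matrix (Fin (k * l : ℕ+)) (Fin (k * l : ℕ+)) S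
  let g₁ : imageCentralizer i →ₐ[R] M := (b.restrictScalars R).comp (i₁.mapMatrix.comp f₁)
  let g₂ : imageCentralizer j →ₐ[R] M := i₂.mapMatrix.comp f₂
  have : Nonempty (Fin (k * l : ℕ+)) := ⟨⟨0, (k * l).pos⟩⟩
  have : IsAzumaya S M := IsAzumaya.matrix _ _
  let F : A ⊗[R] imageCentralizer i →ₐ[R] M ⊗[R] A :=
    Algebra.TensorProduct.lift Algebra.TensorProduct.includeRight
      (Algebra.TensorProduct.includeLeft.comp g₁) fun a y => by
        simp [Commute, SemiconjBy]
  let G : A ⊗[R] imageCentralizer j →ₐ[R] M ⊗[R] A :=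
    Algebra.TensorProduct.lift Algebra.TensorProduct.includeRight
      (Algebra.TensorProduct.includeLeft.comp g₂) fun a y => by
        simp [Commute, SemiconjBy]
  refine ⟨S, inferInstance, inferInstance, inferInstance,
    ⟨RingHom.ker (φ : S →+* Ω), RingHom.ker_isPrime _⟩, M ⊗[R] A, inferInstance, inferInstance,
    inferInstance, inferInstance, inferInstance, F.comp (centralizerEquiv i).symm.toAlgHom,
    G.comp (centralizerEquiv j).symm.toAlgHom, ?_, ?_, ?_⟩
  · ext1
    rw [← hp, PrimeSpectrum.comap_asIdeal, RingHom.comap_ker, φ.comp_algebraMap]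
  · rw [mul_comm n]
    exact hasConstantDegree_tensor_of_isScalarTower (hasConstantDegree_matrix S _) hA
  · ext a
    have h1 := congrArg F (centralizerEquiv_symm_apply i a)
    have h2 := congrArg G (centralizerEquiv_symm_apply j a)
    have h3 : F (a ⊗ₜ 1) = G (a ⊗ₜ 1) := by
      refine (Algebra.TensorProduct.lift_tmul _ _ _ _ _).trans
        (Eq.trans ?_ (Algebra.TensorProduct.lift_tmul _ _ _ _ _).symm)
      rw [map_one, map_one]
    exact h1.trans (h3.trans h2.symm)

end Amalgam

end AzuTop

namespace AzuTop

section Transport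

variable {R S A : Type u} [CommRing R] [CommRing S] [Algebra R S] [Ring A] [Algebra R A]
  [Algebra S A] [IsScalarTower R S A]

/-- Base change along an isomorphism does nothing. -/
def baseChangeEquivOfBijective (h : Function.Bijective (algebraMap R S)) : S ⊗[R] A ≃ₐ[S] A :=
  AlgEquiv.ofBijective (Algebra.TensorProduct.lift (Algebra.ofId S A) (AlgHom.id R A)
    fun s a => by
      rw [Algebra.ofId_apply]; exact Algebra.commute_algebraMap_left s a) (by
    have hs : ∀ t : S ⊗[R] A, ∃ a : A, t = 1 ⊗ₜ a := by
      intro t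
      induction t with
      | zero => exact ⟨0, by simp⟩
      | add x y hx hy =>
        obtain ⟨a, rfl⟩ := hx
        obtain ⟨b, rfl⟩ := hy
        exact ⟨a + b, (TensorProduct.tmul_add _ _ _).symm⟩
      | tmul s a =>
        obtain ⟨r, rfl⟩ := h.2 s
        exact ⟨r • a, by rw [Algebra.algebraMap_eq_smul_one, TensorProduct.smul_tmul]⟩
    refine ⟨?_, fun a => ⟨1 ⊗ₜ a, by simp⟩⟩
    rw [injective_iff_map_eq_zero]
    intro t ht
    obtain ⟨a, rfl⟩ := hs t
    have : a = 0 := by simpa using ht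
    rw [this, TensorProduct.tmul_zero])

lemma isAzumaya_of_bijective (h : Function.Bijective (algebraMap R S)) [IsAzumaya R A] :
    IsAzumaya S A :=
  IsAzumaya.of_AlgEquiv _ _ _ (baseChangeEquivOfBijective (A := A) h)

lemma HasConstantDegree.of_bijective (h : Function.Bijective (algebraMap R S)) [IsAzumaya R A]
    {n : ℕ+} (hA : HasConstantDegree R A n) : HasConstantDegree S A n :=
  (hA.baseChange S).congr (baseChangeEquivOfBijective h)

end Transport

section Lift

lemma exists_baseChange_lift {C D A B : Type*} [CommRing C] [CommRing D] [Algebra C D] [Ring A]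
    [Algebra C A] [Ring B] [Algebra D B] (ψ : A →+* B)
    (hψ : ∀ c, ψ (algebraMap C A c) = algebraMap D B (algebraMap C D c)) :
    ∃ g : D ⊗[C] A →ₐ[D] B, ∀ a, g (1 ⊗ₜ a) = ψ a := by
  let : Algebra C B := Algebra.compHom B (algebraMap C D)
  have : IsScalarTower C D B := IsScalarTower.of_algebraMap_eq fun r => rfl
  let ψ' : A →ₐ[C] B := { ψ with commutes' := hψ }
  refine ⟨Algebra.TensorProduct.lift (Algebra.ofId D B) ψ' fun d a => by
    rw [Algebra.ofId_apply]; exact Algebra.commute_algebraMap_left d _,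
    fun a => ?_⟩
  simp [ψ']

end Lift

variable {P : ObjectProperty (CommAlgCat.{u} ℂ)}

/-- The class of algebras contains `ℂ` and is closed under finitely generated extensions. -/
structure IsClosedUnderFiniteType (P : ObjectProperty (CommAlgCat.{u} ℂ)) : Prop where
  base : P (CommAlgCat.of ℂ (ULift.{u} ℂ))
  extend : ∀ {C D : CommAlgCat.{u} ℂ} (f : C →ₐ[ℂ] D), P C → f.toRingHom.FiniteType → P D

lemma isClosedUnderFiniteType (hP : P = ⊤ ∨ P = finitelyGenerated) : IsClosedUnderFiniteType P := by
  obtain rfl | rfl := hP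
  · exact ⟨trivial, fun _ _ _ => trivial⟩
  · refine ⟨?_, fun {C D} f hC hf => ?_⟩
    · exact Algebra.FiniteType.of_surjective (Algebra.ofId ℂ (ULift.{u} ℂ))
        fun x => ⟨x.down, rfl⟩
    · have h1 : (algebraMap ℂ C).FiniteType := (RingHom.finiteType_algebraMap).2 hC
      have h2 := hf.comp h1
      rw [AlgHom.toRingHom_eq_coe, f.comp_algebraMap] at h2
      exact (RingHom.finiteType_algebraMap).1 h2

namespace Comm

/-- A morphism of `Comm P` from an algebra map. -/
def homMk {C D : Comm P} (f : C.obj →ₐ[ℂ] D.obj) : C ⟶ D :=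
  ObjectProperty.homMk (CommAlgCat.ofHom f)

lemma ringHom_algebraMap {C D : Comm P} (f : C ⟶ D) (c : ℂ) :
    ringHom f (algebraMap ℂ C.obj c) = algebraMap ℂ D.obj c := f.hom.hom.commutes c

lemma hom_ext {C D : Comm P} {f g : C ⟶ D} (h : ∀ c, ringHom f c = ringHom g c) : f = g := by
  apply ObjectProperty.hom_ext
  apply CommAlgCat.hom_ext
  exact AlgHom.ext h

/-- A finitely generated extension of `C` as an object of `Comm P`. -/
def extend (hP : IsClosedUnderFiniteType P) (C : Comm P) (E : Type u) [CommRing E]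
    [Algebra C.obj E] (hE : Algebra.FiniteType C.obj E) : Comm P :=
  letI : Algebra ℂ E := Algebra.compHom E (algebraMap ℂ C.obj)
  ⟨CommAlgCat.of ℂ E, hP.extend (D := CommAlgCat.of ℂ E) (C := C.obj)
    { algebraMap C.obj E with commutes' := fun _ => rfl } C.property
    (RingHom.finiteType_algebraMap.2 hE)⟩

/-- The structure map of a finitely generated extension. -/
def toExtend (hP : IsClosedUnderFiniteType P) (C : Comm P) (E : Type u) [CommRing E]
    [Algebra C.obj E] (hE : Algebra.FiniteType C.obj E) : C ⟶ C.extend hP E hE :=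
  homMk { algebraMap C.obj E with commutes' := fun _ => rfl }

end Comm

namespace Azu

/-- The map on centers induced by a morphism of Azumaya algebras. -/
def centerMap {A B : Azu P} (h : A ⟶ B) : A.center ⟶ B.center :=
  Comm.homMk (C := A.center) (D := B.center)
    ((h.toAlgHom.comp (Subalgebra.val _)).codRestrict (Subalgebra.center ℂ B)
      fun z => h.map_center z z.2)

section Over

variable (hP : IsClosedUnderFiniteType P) (D : Comm P) (B : Type u) [Ring B] [Algebra D.obj B]
  [IsAzumaya D.obj B]

/-- The center of an Azumaya algebra is the base. -/
def baseToCenter [Algebra ℂ B] [IsScalarTower ℂ D.obj B] : D.obj →ₐ[ℂ] Subalgebra.center ℂ B :=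
  (IsScalarTower.toAlgHom ℂ D.obj B).codRestrict _ fun d =>
    Subalgebra.mem_center_iff.2 fun b => (Algebra.commutes d b).symm

lemma baseToCenter_bijective [Algebra ℂ B] [IsScalarTower ℂ D.obj B] :
    Function.Bijective (baseToCenter D B) := by
  constructor
  · intro x y h
    exact FaithfulSMul.algebraMap_injective D.obj B (congrArg Subtype.val h)
  · rintro ⟨z, hz⟩
    obtain ⟨d, hd⟩ := exists_algebraMap_eq_of_central (R := D.obj) (A := B)
      (Subalgebra.mem_center_iff.1 hz)
    exact ⟨d, Subtype.ext hd⟩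

include hP in
lemma over_aux [Algebra ℂ B] [IsScalarTower ℂ D.obj B] :
    IsAzumaya (Subalgebra.center ℂ B) B ∧ P (CommAlgCat.of ℂ (Subalgebra.center ℂ B)) ∧
    ∀ n : ℕ+, HasConstantDegree D.obj B n → HasConstantDegree (Subalgebra.center ℂ B) B n := by
  let : Algebra D.obj (Subalgebra.center ℂ B) := (baseToCenter D B).toRingHom.toAlgebra
  have : IsScalarTower D.obj (Subalgebra.center ℂ B) B := IsScalarTower.of_algebraMap_eq fun _ => rfl
  have hb := baseToCenter_bijective D B
  refine ⟨isAzumaya_of_bijective (R := D.obj) hb, ?_, fun n hn => hn.of_bijective hb⟩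
  exact hP.extend (C := D.obj) (D := CommAlgCat.of ℂ (Subalgebra.center ℂ B)) (baseToCenter D B)
    D.property (RingHom.FiniteType.of_surjective _ hb.2)

/-- An Azumaya algebra over `D` as an object of `Azu P`. -/
def ofBase : Azu P :=
  letI : Algebra ℂ B := Algebra.compHom B (algebraMap ℂ D.obj)
  haveI : IsScalarTower ℂ D.obj B := IsScalarTower.of_algebraMap_eq fun _ => rfl
  { carrier := B
    isAzumaya := (over_aux hP D B).1
    center_prop := (over_aux hP D B).2.1 }

lemma mem_center_over (b : B) :
    b ∈ Subalgebra.center ℂ (ofBase hP D B) ↔ ∃ d : D.obj, algebraMap D.obj B d = b := by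
  constructor
  · intro h
    exact exists_algebraMap_eq_of_central (R := D.obj) (A := B) ((Subalgebra.mem_center_iff (R := ℂ) (A := ofBase hP D B)).1 h)
  · rintro ⟨d, rfl⟩
    exact (Subalgebra.mem_center_iff (R := ℂ) (A := ofBase hP D B)).2 fun (b : B) =>
      (Algebra.commutes (A := B) d b).symm

lemma hasConstantDegree_over {n : ℕ+} (h : HasConstantDegree D.obj B n) :
    HasConstantDegree (Subalgebra.center ℂ (ofBase hP D B)) (ofBase hP D B) n :=
  letI : Algebra ℂ B := Algebra.compHom B (algebraMap ℂ D.obj)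
  haveI : IsScalarTower ℂ D.obj B := IsScalarTower.of_algebraMap_eq fun _ => rfl
  (over_aux hP D B).2.2 n h

variable {D}

/-- A morphism to an Azumaya algebra over `D` that lies over a given map from the center to `D`. -/
def homOver {A : Azu P} (f : A.center ⟶ D) (ψ : A →+* B)
    (hψ : ∀ z : Subalgebra.center ℂ A, ψ z = algebraMap D.obj B (Comm.ringHom f z)) :
    A ⟶ ofBase hP D B where
  toAlgHom :=
    { ψ with
      commutes' := fun c => (hψ (algebraMap ℂ (Subalgebra.center ℂ A) c)).trans
        (congrArg (algebraMap D.obj B) (Comm.ringHom_algebraMap f c)) }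
  map_center z hz := (mem_center_over hP D B _).2 ⟨Comm.ringHom f ⟨z, hz⟩, (hψ ⟨z, hz⟩).symm⟩

end Over

lemma hom_ext {A B : Azu P} {f g : A ⟶ B} (h : ∀ a, f.toAlgHom a = g.toAlgHom a) : f = g :=
  Hom.ext (AlgHom.ext h)

end Azu

end AzuTop

namespace AzuTop

variable {P : ObjectProperty (CommAlgCat.{u} ℂ)}

section Represented

variable (hP : IsClosedUnderFiniteType P)

lemma baseChangeHasDegree_iff (A : Azu P) {D : Comm P} (f : A.center ⟶ D) (n : ℕ+) :
    BaseChangeHasDegree A f n ↔ ∀ p : PrimeSpectrum D.obj,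
      Module.rankAtStalk (R := Subalgebra.center ℂ A) A
        (PrimeSpectrum.comap (Comm.ringHom f : Subalgebra.center ℂ A →+* D.obj) p) =
          (n : ℕ) ^ 2 := by
  have := A.isAzumaya
  let : Algebra (Subalgebra.center ℂ A) D.obj := (Comm.ringHom f).toAlgebra
  refine forall_congr' fun p => ?_
  have h := Module.rankAtStalk_baseChange (R := Subalgebra.center ℂ A) (S := D.obj) (M := A) p
  exact ⟨fun h' => h.symm.trans h', fun h' => h.trans h'⟩

lemma BaseChangeHasDegree.comp {A : Azu P} {D E : Comm P} {f : A.center ⟶ D} {n : ℕ+}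
    (h : BaseChangeHasDegree A f n) (g : D ⟶ E) : BaseChangeHasDegree A (f ≫ g) n := by
  rw [baseChangeHasDegree_iff] at h ⊢
  exact fun p => h (PrimeSpectrum.comap (Comm.ringHom g) p)

lemma represented_of_homOver {A : Azu P} {S : Sieve (op A)} {D : Comm P} {f : A.center ⟶ D}
    {m : ℕ+} (B : Type u) [Ring B] [Algebra D.obj B] [IsAzumaya D.obj B] (ψ : A →+* B)
    (hψ : ∀ z : Subalgebra.center ℂ A, ψ z = algebraMap D.obj B (Comm.ringHom f z))
    (hS : S (Azu.homOver hP B f ψ hψ).op) (hm : HasConstantDegree D.obj B m) :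
    Represented A S f m := by
  let : Algebra (Subalgebra.center ℂ A) D.obj := (Comm.ringHom f).toAlgebra
  obtain ⟨g, hg⟩ := exists_baseChange_lift (C := Subalgebra.center ℂ A) (D := D.obj) ψ hψ
  refine ⟨Azu.ofBase hP D B, g.toRingHom, Azu.homOver hP B f ψ hψ, ⟨?_, ?_, ?_⟩, hg, hS,
    Azu.hasConstantDegree_over hP D B hm⟩
  · intro d _
    exact (Azu.mem_center_over hP D B _).2 ⟨d, (g.commutes d).symm⟩
  · intro d _ d' _ h
    have h' : g (algebraMap D.obj _ d) = g (algebraMap D.obj _ d') := h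
    rw [g.commutes, g.commutes] at h'
    exact FaithfulSMul.algebraMap_injective D.obj B h'
  · intro b hb
    obtain ⟨d, rfl⟩ := (Azu.mem_center_over hP D B _).1 hb
    exact ⟨d, trivial, g.commutes d⟩

lemma Represented.exists_homOver {A : Azu P} {S : Sieve (op A)} {D : Comm P} {f : A.center ⟶ D}
    {m : ℕ+} (h : Represented A S f m) :
    ∃ (B : Type u) (_ : Ring B) (_ : Algebra D.obj B) (_ : IsAzumaya D.obj B) (ψ : A →+* B)
      (hψ : ∀ z : Subalgebra.center ℂ A, ψ z = algebraMap D.obj B (Comm.ringHom f z)),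
      S (Azu.homOver hP B f ψ hψ).op ∧ HasConstantDegree D.obj B m := by
  let _ : Algebra (Subalgebra.center ℂ A) D.obj := (Comm.ringHom f).toAlgebra
  obtain ⟨B, φ, h, hb, hφ, hS, hm⟩ := h
  have hcen : ∀ d : D.obj, φ (d ⊗ₜ 1) ∈ Subalgebra.center ℂ B := fun d => hb.1 trivial
  let ι : D.obj →+* B := φ.comp Algebra.TensorProduct.includeLeftRingHom
  let _ : Algebra D.obj B := ι.toAlgebra' fun d b => (Subalgebra.mem_center_iff.1 (hcen d) b).symm
  let e : D.obj →+* Subalgebra.center ℂ B := ι.codRestrict (Subalgebra.center ℂ B) hcen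
  have he : Function.Bijective e := by
    constructor
    · intro x y hxy
      exact hb.2.1 trivial trivial (congrArg Subtype.val hxy)
    · rintro ⟨z, hz⟩
      obtain ⟨d, -, hd⟩ := hb.2.2 hz
      exact ⟨d, Subtype.ext hd⟩
  let e' := RingEquiv.ofBijective e he
  let _ : Algebra (Subalgebra.center ℂ B) D.obj := e'.symm.toRingHom.toAlgebra
  have : IsScalarTower (Subalgebra.center ℂ B) D.obj B := IsScalarTower.of_algebraMap_eq fun z =>
    (congrArg Subtype.val (e'.apply_symm_apply z)).symm
  have := B.isAzumaya
  have hbij : Function.Bijective (algebraMap (Subalgebra.center ℂ B) D.obj) := e'.symm.bijective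
  have hAz : IsAzumaya D.obj B := isAzumaya_of_bijective (R := Subalgebra.center ℂ B) hbij
  have hψ : ∀ z : Subalgebra.center ℂ A,
      h.toAlgHom z = algebraMap D.obj B (Comm.ringHom f z) := by
    intro z
    rw [← hφ]
    change _ = φ (algebraMap (Subalgebra.center ℂ A) D.obj z ⊗ₜ 1)
    rw [Algebra.algebraMap_eq_smul_one, TensorProduct.smul_tmul, Algebra.smul_def, mul_one]
    rfl
  refine ⟨B, inferInstance, inferInstance, hAz, h.toAlgHom.toRingHom, hψ, ?_,
    hm.of_bijective (R := Subalgebra.center ℂ B) hbij⟩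
  let j : B ⟶ Azu.ofBase hP D B :=
    { toAlgHom :=
        { RingHom.id B with
          commutes' := fun c => by
            have h1 := hψ (algebraMap ℂ (Subalgebra.center ℂ A) c)
            have h2 := Comm.ringHom_algebraMap f c
            refine Eq.trans ?_ (h1.trans (congrArg (algebraMap D.obj B) h2))
            exact (h.toAlgHom.commutes c).symm }
      map_center := fun z hz => (Azu.mem_center_over hP D B z).2
        ⟨(e'.symm ⟨z, hz⟩), congrArg Subtype.val (e'.apply_symm_apply ⟨z, hz⟩)⟩ }
  have hj : (Azu.homOver hP B f h.toAlgHom.toRingHom hψ).op = j.op ≫ h.op := rfl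
  rw [hj]
  exact S.downward_closed hS _

lemma sieve_homOver_comp {A : Azu P} {S : Sieve (op A)} {D E : Comm P} {f : A.center ⟶ D}
    {g : D ⟶ E} {B B' : Type u} [Ring B] [Algebra D.obj B] [IsAzumaya D.obj B] [Ring B']
    [Algebra E.obj B'] [IsAzumaya E.obj B'] {ψ : A →+* B}
    {hψ : ∀ z : Subalgebra.center ℂ A, ψ z = algebraMap D.obj B (Comm.ringHom f z)}
    (hS : S (Azu.homOver hP B f ψ hψ).op) (χ : B →+* B')
    (hχ : ∀ d, χ (algebraMap D.obj B d) = algebraMap E.obj B' (Comm.ringHom g d))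
    {f' : A.center ⟶ E} {ψ' : A →+* B'}
    {hψ' : ∀ z : Subalgebra.center ℂ A, ψ' z = algebraMap E.obj B' (Comm.ringHom f' z)}
    (h : ∀ a, χ (ψ a) = ψ' a) :
    S (Azu.homOver hP B' f' ψ' hψ').op := by
  let j : Azu.ofBase hP D B ⟶ Azu.ofBase hP E B' :=
    { toAlgHom :=
        { χ with
          commutes' := fun c => (hχ _).trans
            (congrArg (algebraMap E.obj B') (Comm.ringHom_algebraMap g c)) }
      map_center := fun z hz => by
        obtain ⟨d, rfl⟩ := (Azu.mem_center_over hP D B z).1 hz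
        exact (Azu.mem_center_over hP E B' _).2 ⟨_, (hχ d).symm⟩ }
  have hj : (Azu.homOver hP B' f' ψ' hψ').op = j.op ≫ (Azu.homOver hP B f ψ hψ).op := by
    rw [← op_comp]
    congr 1
    exact Azu.hom_ext fun a => (h a).symm
  rw [hj]
  exact S.downward_closed hS _

include hP in
lemma Represented.comp {A : Azu P} {S : Sieve (op A)} {D E : Comm P} {f : A.center ⟶ D}
    {m : ℕ+} (h : Represented A S f m) (g : D ⟶ E) : Represented A S (f ≫ g) m := by
  obtain ⟨B, _, _, _, ψ, hψ, hS, hm⟩ := h.exists_homOver hP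
  let : Algebra D.obj E.obj := (Comm.ringHom g).toAlgebra
  let χ : B →+* E.obj ⊗[D.obj] B := (Algebra.TensorProduct.includeRight :
    B →ₐ[D.obj] E.obj ⊗[D.obj] B).toRingHom
  have hχ : ∀ d, χ (algebraMap D.obj B d) = algebraMap E.obj _ (Comm.ringHom g d) := fun d =>
    ((Algebra.TensorProduct.includeRight : B →ₐ[D.obj] E.obj ⊗[D.obj] B).commutes d).trans
      (IsScalarTower.algebraMap_apply D.obj E.obj _ d)
  exact represented_of_homOver hP (E.obj ⊗[D.obj] B) (χ.comp ψ)
    (fun z => (congrArg χ (hψ z)).trans (hχ _)) (sieve_homOver_comp hP hS χ hχ fun _ => rfl)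
    (hm.baseChange E.obj)

include hP in
lemma Represented.of_dvd {A : Azu P} {S : Sieve (op A)} {D : Comm P} {f : A.center ⟶ D}
    {m m' : ℕ+} (h : Represented A S f m) (hm' : m ∣ m') : Represented A S f m' := by
  obtain ⟨B, _, _, _, ψ, hψ, hS, hm⟩ := h.exists_homOver hP
  obtain ⟨k, rfl⟩ := hm'
  have : Nonempty (Fin k) := ⟨⟨0, k.pos⟩⟩
  have : IsAzumaya D.obj (Matrix (Fin k) (Fin k) D.obj) := IsAzumaya.matrix _ _
  let χ := (Algebra.TensorProduct.includeLeft :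
    B →ₐ[D.obj] B ⊗[D.obj] Matrix (Fin k) (Fin k) D.obj)
  exact represented_of_homOver hP (B ⊗[D.obj] Matrix (Fin k) (Fin k) D.obj) (χ.toRingHom.comp ψ)
    (fun z => (congrArg χ (hψ z)).trans (χ.commutes _))
    (sieve_homOver_comp hP (g := 𝟙 D) hS χ.toRingHom χ.commutes fun _ => rfl)
    (hm.tensor (hasConstantDegree_matrix D.obj k))

end Represented

end AzuTop

namespace AzuTop

variable {P : ObjectProperty (CommAlgCat.{u} ℂ)}

section CentrallyCovered

variable (hP : IsClosedUnderFiniteType P) {K : GrothendieckTopology DivPoset}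

/-- The multiples of `n` that are represented on `f`. -/
def representedSieve {A : Azu P} (S : Sieve (op A)) {D : Comm P} (f : A.center ⟶ D) (n : ℕ+) :
    Sieve (⟨n⟩ : DivPoset) where
  arrows m _ := Represented A S f m.val
  downward_closed h g := h.of_dvd hP (leOfHom g)

lemma centrallyCovered_iff {A : Azu P} {S : Sieve (op A)} {D : Comm P} {f : A.center ⟶ D} :
    CentrallyCovered K A S f ↔
      ∃ n, BaseChangeHasDegree A f n ∧ representedSieve hP S f n ∈ K ⟨n⟩ := by
  refine exists_congr fun n => and_congr_right fun _ => ⟨?_, fun h => ⟨_, h, fun _ _ => Iff.rfl⟩⟩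
  rintro ⟨T, hT, h⟩
  have : T = representedSieve hP S f n := Sieve.ext fun m g => h m g
  rwa [← this]

include hP in
lemma CentrallyCovered.comp {A : Azu P} {S : Sieve (op A)} {D E : Comm P} {f : A.center ⟶ D}
    (h : CentrallyCovered K A S f) (g : D ⟶ E) : CentrallyCovered K A S (f ≫ g) := by
  obtain ⟨n, hn, hT⟩ := (centrallyCovered_iff hP).1 h
  exact (centrallyCovered_iff hP).2
    ⟨n, hn.comp g, K.superset_covering (fun m _ hm => Represented.comp hP hm g) hT⟩

variable (K) in
/-- The sieve of the centrally covered morphisms. -/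
def centralSieve {A : Azu P} (S : Sieve (op A)) : Sieve (op A.center) where
  arrows _ f := CentrallyCovered K A S f.unop
  downward_closed h g := h.comp hP g.unop

lemma jkCovering_iff {J : GrothendieckTopology (Comm P)ᵒᵖ} {A : Azu P} {S : Sieve (op A)} :
    JKCovering J K A S ↔ centralSieve hP K S ∈ J (op A.center) := by
  refine ⟨?_, fun h => ⟨_, h, fun _ _ => Iff.rfl⟩⟩
  rintro ⟨T, hT, h⟩
  have : T = centralSieve hP K S := Sieve.ext fun D f => h D.unop f.unop
  rwa [← this]

end CentrallyCovered

section Local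

variable (hP : IsClosedUnderFiniteType P)

lemma mem_zariskiTopology {C : Comm P} {U : Sieve (op C)}
    (h : ∀ p : PrimeSpectrum C.obj, ∃ r ∉ p.asIdeal, U (C.toExtend hP (Localization.Away r)
      (IsLocalization.finiteType_of_monoid_fg (Submonoid.powers r) _)).op) :
    U ∈ zariskiTopology P (op C) := by
  choose r hr hU using h
  have hspan : Ideal.span (Set.range r) = ⊤ := by
    by_contra hne
    obtain ⟨M, hM, hle⟩ := Ideal.exists_le_maximal _ hne
    exact hr ⟨M, hM.isPrime⟩ (hle (Ideal.subset_span ⟨_, rfl⟩))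
  obtain ⟨s, hs, hs'⟩ := (Ideal.span_eq_top_iff_finite _).1 hspan
  choose p hp using fun i : Fin s.card => hs (s.equivFin.symm i).2
  refine (zariskiTopology P).superset_covering (S := Sieve.generate (Presieve.ofArrows
    (fun i : Fin s.card => op (C.extend hP (Localization.Away (r (p i))) _))
    (fun i => (C.toExtend hP (Localization.Away (r (p i)))
      (IsLocalization.finiteType_of_monoid_fg (Submonoid.powers (r (p i))) _)).op))) ?_ ?_
  · rw [Sieve.generate_le_iff]
    rintro _ _ ⟨i⟩
    exact hU _
  · refine Precoverage.generate_mem_toGrothendieck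
      ⟨s.card, _, _, fun i => r (p i), ?_, fun i => ?_, rfl⟩
    · rw [← hs']
      congr 1
      ext x
      simp only [hp, Set.mem_range, Finset.mem_coe]
      exact ⟨fun ⟨i, hi⟩ => hi ▸ (s.equivFin.symm i).2, fun hx => ⟨s.equivFin ⟨x, hx⟩, by simp⟩⟩
    · have h : IsLocalization.Away (r (p i)) (Localization.Away (r (p i))) := inferInstance
      exact @IsLocalization'.mk _ _ _ _ _ (_) h.toIsLocalizationMap

lemma mem_etaleTopology {C : Comm P} {U : Sieve (op C)}
    (h : ∀ p : PrimeSpectrum C.obj, ∃ (E : Type u) (_ : CommRing E) (_ : Algebra C.obj E)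
      (_ : Algebra.Etale C.obj E) (q : PrimeSpectrum E),
      PrimeSpectrum.comap (algebraMap C.obj E) q = p ∧ U (C.toExtend hP E inferInstance).op) :
    U ∈ etaleTopology P (op C) := by
  choose E _ _ _ q hq hU using h
  have hopen : ∀ p, IsOpen (Set.range (PrimeSpectrum.comap (algebraMap C.obj (E p)))) := fun p =>
    PrimeSpectrum.isOpenMap_comap_of_hasGoingDown_of_finitePresentation.isOpen_range
  obtain ⟨t, ht⟩ := isCompact_univ.elim_finite_subcover _ hopen fun p _ =>
    Set.mem_iUnion.2 ⟨p, q p, hq p⟩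
  refine (etaleTopology P).superset_covering (S := Sieve.generate (Presieve.ofArrows
    (fun i : Fin t.card => op (C.extend hP (E (t.equivFin.symm i)) inferInstance))
    (fun i => (C.toExtend hP (E (t.equivFin.symm i)) inferInstance).op))) ?_ ?_
  · rw [Sieve.generate_le_iff]
    rintro _ _ ⟨i⟩
    exact hU _
  · refine Precoverage.generate_mem_toGrothendieck ⟨t.card, _, _, fun i => ?_, fun p => ?_, rfl⟩
    · exact (RingHom.etale_algebraMap (R := C.obj) (S := E _)).2 inferInstance
    · obtain ⟨p', hp', q', hq'⟩ := Set.mem_iUnion₂.1 (ht (Set.mem_univ p))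
      obtain ⟨i, hi⟩ := t.equivFin.symm.surjective ⟨p', hp'⟩
      have hi' : (t.equivFin.symm i : PrimeSpectrum C.obj) = p' := by rw [hi]
      subst hi'
      exact ⟨i, q', hq'⟩

lemma zariskiTopology_le_etaleTopology : zariskiTopology P ≤ etaleTopology P := by
  apply Precoverage.toGrothendieck_mono
  rintro C _ ⟨k, X, g, r, hr, hg, rfl⟩
  refine ⟨k, X, g, fun i => ?_, fun p => ?_, rfl⟩
  · let _ := (Comm.ringHom (g i)).toAlgebra
    have := hg i
    exact Algebra.Etale.of_isLocalizationAway (r i)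
  · have : ∃ i, r i ∉ p.asIdeal := by
      by_contra! h
      refine p.2.ne_top (top_le_iff.1 (hr ▸ Ideal.span_le.2 ?_))
      rintro _ ⟨i, rfl⟩
      exact h i
    obtain ⟨i, hi⟩ := this
    let _ := (Comm.ringHom (g i)).toAlgebra
    have := hg i
    have h := PrimeSpectrum.localization_away_comap_range (X i).obj (r i)
    have hp : p ∈ (PrimeSpectrum.basicOpen (r i) : Set (PrimeSpectrum C.unop.obj)) := hi
    rw [← h] at hp
    obtain ⟨q, hq⟩ := hp
    exact ⟨i, q, hq⟩

lemma Admissible.zariski_le {J : GrothendieckTopology (Comm P)ᵒᵖ}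
    {K : GrothendieckTopology DivPoset} (h : Admissible J K) : zariskiTopology P ≤ J := by
  obtain h | h := h.2
  · exact zariskiTopology_le_etaleTopology.trans h
  · exact h.1

include hP in
lemma mem_of_subsingleton {J : GrothendieckTopology (Comm P)ᵒᵖ} (hJ : zariskiTopology P ≤ J)
    {C : Comm P} [Subsingleton C.obj] (U : Sieve (op C)) : U ∈ J (op C) :=
  hJ _ (mem_zariskiTopology hP fun p =>
    (not_subsingleton_iff_nontrivial.2 p.nontrivial inferInstance).elim)

/-- The sieve of the base changes of constant degree. -/
def constantDegreeSieve (A : Azu P) : Sieve (op A.center) where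
  arrows _ f := ∃ n, BaseChangeHasDegree A f.unop n
  downward_closed := fun ⟨n, hn⟩ g => ⟨n, hn.comp g.unop⟩

include hP in
lemma constantDegreeSieve_mem (A : Azu P) :
    constantDegreeSieve A ∈ zariskiTopology P (op A.center) := by
  have := A.isAzumaya
  apply mem_zariskiTopology hP
  intro (p : PrimeSpectrum (Subalgebra.center ℂ A))
  obtain ⟨n, hn⟩ : ∃ n : ℕ+, Module.rankAtStalk (R := Subalgebra.center ℂ A) A p = (n : ℕ) ^ 2 :=
    exists_rankAtStalk_eq_sq _ _ p
  have : Module.FinitePresentation (Subalgebra.center ℂ A) A := Module.finitePresentation_of_projective _ _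
  have ho : IsOpen {q | Module.rankAtStalk (R := Subalgebra.center ℂ A) A q = (n : ℕ) ^ 2} :=
    Module.isLocallyConstant_rankAtStalk.isOpen_fiber _
  obtain ⟨_, ⟨r, rfl⟩, hpr, hr⟩ :=
    PrimeSpectrum.isTopologicalBasis_basic_opens.exists_subset_of_mem_open hn ho
  refine ⟨r, hpr, n, (baseChangeHasDegree_iff A _ n).2 fun q => ?_⟩
  apply hr
  have h := PrimeSpectrum.localization_away_comap_range (Localization.Away r) r
  change _ ∈ (PrimeSpectrum.basicOpen r : Set (PrimeSpectrum (Subalgebra.center ℂ A)))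
  rw [← h]
  exact ⟨q, rfl⟩

end Local

end AzuTop

namespace AzuTop

variable {P : ObjectProperty (CommAlgCat.{u} ℂ)}

section BaseChange

/-- The base change of an Azumaya algebra along a map from its center, with its universal
property. -/
lemma exists_baseChange (A : Azu P) {D : Comm P} (f : A.center ⟶ D) :
    ∃ (A' : Type u) (_ : Ring A') (_ : Algebra D.obj A') (_ : IsAzumaya D.obj A') (ψ : A →+* A'),
      (∀ z : Subalgebra.center ℂ A, ψ z = algebraMap D.obj A' (Comm.ringHom f z)) ∧
      (∀ n, BaseChangeHasDegree A f n → HasConstantDegree D.obj A' n) ∧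
      ∀ (B : Type u) (_ : Ring B) (_ : Algebra D.obj B) (φ : A →+* B),
        (∀ z : Subalgebra.center ℂ A, φ z = algebraMap D.obj B (Comm.ringHom f z)) →
        ∃ g : A' →ₐ[D.obj] B, ∀ a, g (ψ a) = φ a := by
  have := A.isAzumaya
  let : Algebra (Subalgebra.center ℂ A) D.obj := (Comm.ringHom f).toAlgebra
  let ι := (Algebra.TensorProduct.includeRight : A →ₐ[Subalgebra.center ℂ A]
    D.obj ⊗[Subalgebra.center ℂ A] A)
  refine ⟨D.obj ⊗[Subalgebra.center ℂ A] A, inferInstance, inferInstance, inferInstance,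
    ι.toRingHom, fun z => (ι.commutes z).trans
      (IsScalarTower.algebraMap_apply (Subalgebra.center ℂ A) D.obj _ z), fun n hn => hn, ?_⟩
  intro B _ _ φ hφ
  exact exists_baseChange_lift (C := Subalgebra.center ℂ A) (D := D.obj) φ hφ

variable (hP : IsClosedUnderFiniteType P)

include hP in
lemma represented_top {A : Azu P} {D : Comm P} {f : A.center ⟶ D} {n : ℕ+}
    (h : BaseChangeHasDegree A f n) : Represented A ⊤ f n := by
  obtain ⟨A', _, _, _, ψ, hψ, hn, -⟩ := exists_baseChange A f
  exact represented_of_homOver hP A' ψ hψ trivial (hn n h)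

include hP in
lemma Represented.of_pullback {A A' : Azu P} {S : Sieve (op A)} {D : Comm P} (h : A ⟶ A')
    {g : A'.center ⟶ D} {m : ℕ+} (H : Represented A' (S.pullback h.op) g m) :
    Represented A S (Azu.centerMap h ≫ g) m := by
  obtain ⟨B, _, _, _, ψ, hψ, hS, hm⟩ := H.exists_homOver hP
  exact represented_of_homOver hP B (ψ.comp h.toAlgHom.toRingHom)
    (fun z => hψ (Comm.ringHom (Azu.centerMap h) z)) hS hm

section Pullback

variable {A A' : Azu P} {S : Sieve (op A)} {D : Comm P} {h : A ⟶ A'} {g : A'.center ⟶ D}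
  {m n n' : ℕ+}

lemma BaseChangeHasDegree.dvd [Nontrivial D.obj]
    (hn : BaseChangeHasDegree A (Azu.centerMap h ≫ g) n) (hn' : BaseChangeHasDegree A' g n') :
    n ∣ n' := by
  obtain ⟨A₁, _, _, _, ψ₁, hψ₁, hn₁, H₁⟩ := exists_baseChange A (Azu.centerMap h ≫ g)
  obtain ⟨A₂, _, _, _, ψ₂, hψ₂, hn₂, -⟩ := exists_baseChange A' g
  obtain ⟨i, hi⟩ := H₁ A₂ _ _ (ψ₂.comp h.toAlgHom.toRingHom)
    fun z => hψ₂ (Comm.ringHom (Azu.centerMap h) z)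
  obtain ⟨k, hk, -⟩ := (hn₁ n hn).exists_imageCentralizer (hn₂ n' hn') i
  exact ⟨k, hk⟩

include hP in
lemma Represented.pullback [Nontrivial D.obj]
    (hm : Represented A S (Azu.centerMap h ≫ g) m)
    (hn : BaseChangeHasDegree A (Azu.centerMap h ≫ g) n) {k : ℕ+}
    (hn' : BaseChangeHasDegree A' g (n * k)) :
    Represented A' (S.pullback h.op) g (m * k) := by
  obtain ⟨B, _, _, _, ψ, hψ, hS, hm⟩ := hm.exists_homOver hP
  obtain ⟨A₁, _, _, _, ψ₁, hψ₁, hn₁, H₁⟩ := exists_baseChange A (Azu.centerMap h ≫ g)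
  obtain ⟨A₂, _, _, _, ψ₂, hψ₂, hn₂, -⟩ := exists_baseChange A' g
  obtain ⟨i, hi⟩ := H₁ A₂ _ _ (ψ₂.comp h.toAlgHom.toRingHom)
    fun z => hψ₂ (Comm.ringHom (Azu.centerMap h) z)
  obtain ⟨j, hj⟩ := H₁ B _ _ ψ hψ
  obtain ⟨k', hk, B', _, _, _, f', g', hd, hfg⟩ := exists_amalgam (hn₁ n hn) (hn₂ _ hn') hm i j
  obtain rfl := mul_left_cancel hk
  refine represented_of_homOver hP B' (f'.toRingHom.comp ψ₂)
    (fun z => (congrArg f' (hψ₂ z)).trans (f'.commutes _)) ?_ hd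
  refine sieve_homOver_comp hP (f' := Azu.centerMap h ≫ g) (g := 𝟙 D)
    (ψ' := (f'.toRingHom.comp ψ₂).comp h.toAlgHom.toRingHom)
    (hψ' := fun z => (congrArg f' (hψ₂ (Comm.ringHom (Azu.centerMap h) z))).trans (f'.commutes _))
    hS g'.toRingHom g'.commutes fun a => ?_
  exact (congrArg g' (hj a)).symm.trans ((AlgHom.congr_fun hfg (ψ₁ a)).symm.trans
    (congrArg f' (hi a)))

include hP in
lemma Represented.pullback_etale (hm : Represented A S (Azu.centerMap h ≫ g) m)
    (hn : BaseChangeHasDegree A (Azu.centerMap h ≫ g) n) (hn' : BaseChangeHasDegree A' g n')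
    (hd : n' ∣ m) (p : PrimeSpectrum D.obj) :
    ∃ (E : Type u) (_ : CommRing E) (_ : Algebra D.obj E) (_ : Algebra.Etale D.obj E)
      (q : PrimeSpectrum E), PrimeSpectrum.comap (algebraMap D.obj E) q = p ∧
      Represented A' (S.pullback h.op) (g ≫ D.toExtend hP E inferInstance) m := by
  obtain ⟨B, _, _, _, ψ, hψ, hS, hm⟩ := hm.exists_homOver hP
  obtain ⟨A₁, _, _, _, ψ₁, hψ₁, hn₁, H₁⟩ := exists_baseChange A (Azu.centerMap h ≫ g)
  obtain ⟨A₂, _, _, _, ψ₂, hψ₂, hn₂, -⟩ := exists_baseChange A' g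
  obtain ⟨i, hi⟩ := H₁ A₂ _ _ (ψ₂.comp h.toAlgHom.toRingHom)
    fun z => hψ₂ (Comm.ringHom (Azu.centerMap h) z)
  obtain ⟨j, hj⟩ := H₁ B _ _ ψ hψ
  have hR : ∀ m : ℕ, m ≠ 0 → IsUnit (m : D.obj) := fun m hm => by
    have := (Ne.isUnit (a := (m : ℂ)) (by exact_mod_cast hm)).map (algebraMap ℂ D.obj)
    rwa [map_natCast] at this
  obtain ⟨E, _, _, hE, q, B', _, _, _, _, _, f', g', hq, hd, hfg⟩ :=
    exists_etale_amalgam hR p (hn₁ n hn) (hn₂ n' hn') hm hd i j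
  refine ⟨E, _, _, hE, q, hq, ?_⟩
  let _ : Algebra (D.extend hP E inferInstance).obj B' := ‹Algebra E B'›
  have : IsAzumaya (D.extend hP E inferInstance).obj B' := ‹IsAzumaya E B'›
  have hf : ∀ z : Subalgebra.center ℂ A', f' (ψ₂ z) =
      algebraMap (D.extend hP E inferInstance).obj B'
        (Comm.ringHom (g ≫ D.toExtend hP E inferInstance) z) := fun z =>
    (congrArg f' (hψ₂ z)).trans ((f'.commutes _).trans (IsScalarTower.algebraMap_apply D.obj E B' _))
  refine represented_of_homOver hP (D := D.extend hP E inferInstance) B'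
    (f'.toRingHom.comp ψ₂) hf ?_ hd
  refine sieve_homOver_comp hP (f' := Azu.centerMap h ≫ g ≫ D.toExtend hP E inferInstance)
    (g := D.toExtend hP E inferInstance)
    (ψ' := (f'.toRingHom.comp ψ₂).comp h.toAlgHom.toRingHom)
    (hψ' := fun z => hf (Comm.ringHom (Azu.centerMap h) z))
    hS g'.toRingHom (fun d => (g'.commutes d).trans (IsScalarTower.algebraMap_apply D.obj E B' _))
    fun a => ?_
  exact (congrArg g' (hj a)).symm.trans ((AlgHom.congr_fun hfg (ψ₁ a)).symm.trans
    (congrArg f' (hi a)))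

end Pullback

end BaseChange

namespace Azu

variable (hP : IsClosedUnderFiniteType P) (D : Comm P) (B : Type u) [Ring B] [Algebra D.obj B]
  [IsAzumaya D.obj B]

/-- The center of an Azumaya algebra over `D` is `D`. -/
def fromCenter : (ofBase hP D B).center ⟶ D :=
  letI : Algebra ℂ B := Algebra.compHom B (algebraMap ℂ D.obj)
  haveI : IsScalarTower ℂ D.obj B := IsScalarTower.of_algebraMap_eq fun _ => rfl
  Comm.homMk (C := (ofBase hP D B).center) (D := D)
    (AlgEquiv.ofBijective (baseToCenter D B) (baseToCenter_bijective D B)).symm.toAlgHom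

lemma algebraMap_fromCenter (z : Subalgebra.center ℂ (ofBase hP D B)) :
    @Eq B (algebraMap D.obj B (Comm.ringHom (fromCenter hP D B) z)) z.1 :=
  letI : Algebra ℂ B := Algebra.compHom B (algebraMap ℂ D.obj)
  haveI : IsScalarTower ℂ D.obj B := IsScalarTower.of_algebraMap_eq fun _ => rfl
  congrArg Subtype.val
    ((AlgEquiv.ofBijective (baseToCenter D B) (baseToCenter_bijective D B)).apply_symm_apply z)

variable {D}

lemma centerMap_homOver_fromCenter {A : Azu P} (f : A.center ⟶ D) (ψ : A →+* B)
    (hψ : ∀ z : Subalgebra.center ℂ A, ψ z = algebraMap D.obj B (Comm.ringHom f z)) :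
    centerMap (homOver hP B f ψ hψ) ≫ fromCenter hP D B = f :=
  Comm.hom_ext fun z : Subalgebra.center ℂ A => FaithfulSMul.algebraMap_injective D.obj B
    ((algebraMap_fromCenter hP D B _).trans (hψ z))

lemma baseChangeHasDegree_fromCenter {n : ℕ+} (h : HasConstantDegree D.obj B n) :
    BaseChangeHasDegree (ofBase hP D B) (fromCenter hP D B) n :=
  (baseChangeHasDegree_iff _ _ _).2 fun _ => hasConstantDegree_over hP D B h _

end Azu

lemma BaseChangeHasDegree.unique {A : Azu P} {D : Comm P} [Nontrivial D.obj] {f : A.center ⟶ D}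
    {n n' : ℕ+} (h : BaseChangeHasDegree A f n) (h' : BaseChangeHasDegree A f n') : n = n' := by
  let : Algebra (Subalgebra.center ℂ A) D.obj := (Comm.ringHom f).toAlgebra
  exact HasConstantDegree.unique (R := D.obj) (A := D.obj ⊗[Subalgebra.center ℂ A] A) h h'

end AzuTop

namespace AzuTop

section

variable {𝒞 : Type*} [Category 𝒞] (J : GrothendieckTopology 𝒞)

lemma exists_mem_le_of_forall_mem {X : 𝒞} {ι : Type*} [Fintype ι] (V : ι → Sieve X)
    (hV : ∀ i, V i ∈ J X) : ∃ W ∈ J X, ∀ i, W ≤ V i :=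
  ⟨Finset.univ.inf V, Finset.inf_induction (J.top_mem X)
    (fun _ h _ h' => J.intersection_covering h h') fun i _ => hV i,
    fun i => Finset.inf_le (Finset.mem_univ i)⟩

lemma mem_of_ofArrows {X : 𝒞} {ι : Type*} {Y : ι → 𝒞} {g : ∀ i, Y i ⟶ X} {S : Sieve X}
    (h : Sieve.ofArrows Y g ∈ J X) (hS : ∀ i, S.pullback (g i) ∈ J (Y i)) : S ∈ J X := by
  refine J.transitive h S fun Z f hf => ?_
  obtain ⟨W, a, b, ⟨i⟩, rfl⟩ := hf
  rw [Sieve.pullback_comp]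
  exact J.pullback_stable a (hS i)

end

variable {P : ObjectProperty (CommAlgCat.{u} ℂ)}

variable (hP : IsClosedUnderFiniteType P) {J : GrothendieckTopology (Comm P)ᵒᵖ}
  {K : GrothendieckTopology DivPoset}

include hP in
lemma mem_of_local (hJ : zariskiTopology P ≤ J) {C : Comm P} {U W : Sieve (op C)}
    (hW : W ∈ J (op C)) (h : ∀ (D : Comm P) (f : C ⟶ D), Nontrivial D.obj → W f.op →
      U.pullback f.op ∈ J (op D)) : U ∈ J (op C) := by
  refine J.transitive hW U fun D f hf => ?_
  obtain hD | hD := subsingleton_or_nontrivial D.unop.obj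
  · exact mem_of_subsingleton hP hJ _
  · exact h D.unop f.unop hD hf

section Pullback

variable {A A' : Azu P} {S : Sieve (op A)} {h : A ⟶ A'} {D : Comm P} {g : A'.center ⟶ D} {n : ℕ+}

include hP in
lemma CentrallyCovered.pullback_of_stableUnderMul [Nontrivial D.obj]
    (hK : DivPoset.StableUnderMul K) (hS : CentrallyCovered K A S (Azu.centerMap h ≫ g))
    (hn : BaseChangeHasDegree A' g n) : CentrallyCovered K A' (S.pullback h.op) g := by
  obtain ⟨m, hm, hT⟩ := (centrallyCovered_iff hP).1 hS
  obtain ⟨k, rfl⟩ := hm.dvd hn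
  refine (centrallyCovered_iff hP).2 ⟨_, hn, K.superset_covering ?_ (hK _ _ hT k)⟩
  rw [Sieve.generate_le_iff]
  rintro _ _ ⟨l, _, hl, rfl⟩
  exact Represented.pullback hP hl hm hn

/-- The base extensions along which `m` is represented. -/
def representedBaseSieve {A : Azu P} (S : Sieve (op A)) {D : Comm P} (f : A.center ⟶ D) (m : ℕ+) :
    Sieve (op D) where
  arrows _ e := Represented A S (f ≫ e.unop) m
  downward_closed h e := h.comp hP e.unop

include hP in
lemma CentrallyCovered.pullback_of_etale_le [Nontrivial D.obj] (hJ : etaleTopology P ≤ J)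
    (hK : DivPoset.FinitelyRefinable K) (hS : CentrallyCovered K A S (Azu.centerMap h ≫ g))
    (hn : BaseChangeHasDegree A' g n) :
    (centralSieve hP K (S.pullback h.op)).pullback g.op ∈ J (op D) := by
  obtain ⟨m, hm, hT⟩ := (centrallyCovered_iff hP).1 hS
  let u : (⟨n⟩ : DivPoset) ⟶ ⟨m⟩ := homOfLE (hm.dvd hn)
  obtain ⟨r, l, v, hl, hlK⟩ := hK _ _ (K.pullback_stable u hT)
  obtain ⟨W, hW, hWl⟩ := exists_mem_le_of_forall_mem J
    (fun i => representedBaseSieve hP (S.pullback h.op) g (l i).val) fun i =>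
      hJ _ (mem_etaleTopology hP fun p => Represented.pullback_etale hP
        (hl _ (Sieve.ofArrows_mk _ _ i)) hm hn (leOfHom (v i)) p)
  refine J.superset_covering (fun E e he => ?_) hW
  refine (centrallyCovered_iff hP).2 ⟨n, hn.comp e.unop, K.superset_covering ?_ hlK⟩
  rw [Sieve.generate_le_iff]
  rintro _ _ ⟨i⟩
  exact hWl i _ he

include hP in
lemma centralSieve_pullback_mem (hJK : Admissible J K) (h : A ⟶ A')
    (hS : centralSieve hP K S ∈ J (op A.center)) :
    centralSieve hP K (S.pullback h.op) ∈ J (op A'.center) := by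
  have hZ := hJK.zariski_le
  refine mem_of_local hP hZ (J.intersection_covering
    (J.pullback_stable (Azu.centerMap h).op hS) (hZ _ (constantDegreeSieve_mem hP A')))
    fun D g hD hg => ?_
  obtain ⟨hg, n, hn⟩ := hg
  obtain hJ | ⟨-, hK⟩ := hJK.2
  · exact CentrallyCovered.pullback_of_etale_le hP hJ hJK.1 hg hn
  · exact J.covering_of_eq_top (Sieve.pullback_eq_top_of_mem _
      (CentrallyCovered.pullback_of_stableUnderMul hP hK hg hn))

end Pullback

section Transitivity

variable {A : Azu P} {S R : Sieve (op A)} {D : Comm P} {f : A.center ⟶ D}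

include hP in
lemma centralSieve_pullback_mem_of_centrallyCovered (hJK : Admissible J K)
    (hf : CentrallyCovered K A S f)
    (hR : ∀ (B : Azu P) (h : A ⟶ B), S h.op →
      centralSieve hP K (R.pullback h.op) ∈ J (op B.center)) :
    (centralSieve hP K R).pullback f.op ∈ J (op D) := by
  obtain ⟨n, hn, hT⟩ := (centrallyCovered_iff hP).1 hf
  obtain ⟨r, l, v, hl, hlK⟩ := hJK.1 _ _ hT
  choose B _ _ _ ψ hψ hS hB using fun i =>
    Represented.exists_homOver hP (hl _ (Sieve.ofArrows_mk _ _ i))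
  obtain ⟨W, hW, hWl⟩ := exists_mem_le_of_forall_mem J _ fun i =>
    J.pullback_stable (Azu.fromCenter hP D (B i)).op (hR _ _ (hS i))
  refine mem_of_local hP hJK.zariski_le hW fun E e hE he => ?_
  refine J.covering_of_eq_top (Sieve.pullback_eq_top_of_mem _ ?_)
  refine (centrallyCovered_iff hP).2 ⟨n, hn.comp e, mem_of_ofArrows K hlK fun i => ?_⟩
  obtain ⟨k, hk, hk'⟩ := (centrallyCovered_iff hP).1 (hWl i _ he)
  obtain rfl := hk.unique ((Azu.baseChangeHasDegree_fromCenter hP (B i) (hB i)).comp e)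
  refine K.superset_covering (fun m w hm => ?_) hk'
  have H := Represented.of_pullback hP (g := Azu.fromCenter hP D (B i) ≫ e)
    (Azu.homOver hP (B i) f (ψ i) (hψ i)) hm
  rw [← Category.assoc, Azu.centerMap_homOver_fromCenter] at H
  exact H

end Transitivity

/-- The topology whose covering sieves are the `J_K`-covering sieves. -/
def jkTopology (hJK : Admissible J K) : GrothendieckTopology (Azu P)ᵒᵖ where
  sieves A := {S | centralSieve hP K (A := A.unop) S ∈ J (op A.unop.center)}
  top_mem' A := J.superset_covering (S := constantDegreeSieve A.unop)
    (fun _ _ ⟨n, hn⟩ => (centrallyCovered_iff hP).2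
      ⟨n, hn, K.covering_of_eq_top ((Sieve.id_mem_iff_eq_top).1 (represented_top hP hn))⟩)
    (hJK.zariski_le _ (constantDegreeSieve_mem hP A.unop))
  pullback_stable' _ _ _ h hS := centralSieve_pullback_mem hP hJK h.unop hS
  transitive' _ _ hS _ hR := J.transitive hS _ fun _ f hf =>
    centralSieve_pullback_mem_of_centrallyCovered hP (f := f.unop) hJK hf
      fun _ _ hh => hR hh

lemma isTopologyJK_jkTopology (hJK : Admissible J K) : IsTopologyJK J K (jkTopology hP hJK) :=
  fun _ _ => (jkCovering_iff hP).symm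

end AzuTop

namespace AzuTop

variable {P : ObjectProperty (CommAlgCat.{u} ℂ)}

section Discrete

variable (hP : IsClosedUnderFiniteType P) {J : GrothendieckTopology (Comm P)ᵒᵖ}
  {K : GrothendieckTopology DivPoset} {T : GrothendieckTopology (Azu P)ᵒᵖ}

lemma mem_of_bot_mem {𝒞 : Type*} [Category 𝒞] (J : GrothendieckTopology 𝒞) {X Y : 𝒞}
    (h : ⊥ ∈ J X) (f : Y ⟶ X) (S : Sieve Y) : S ∈ J Y :=
  J.superset_covering (S := Sieve.pullback f ⊥) (fun _ _ h => h.elim) (J.pullback_stable f h)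

include hP in
lemma bot_notMem_divPoset (hT : IsTopologyJK J K T) (hJ : zariskiTopology P ≤ J)
    (hd : T ≠ GrothendieckTopology.discrete _) : ⊥ ∉ K ⟨1⟩ := by
  refine fun h => hd (top_le_iff.1 fun A S _ => (hT A.unop S).2 ((jkCovering_iff hP).2 ?_))
  refine J.superset_covering ?_ (hJ _ (constantDegreeSieve_mem hP A.unop))
  rintro D f ⟨n, hn⟩
  exact (centrallyCovered_iff hP).2 ⟨n, hn, mem_of_bot_mem K h (homOfLE (one_dvd n)) _⟩

include hP in
lemma bot_notMem_comm (hT : IsTopologyJK J K T) (hd : T ≠ GrothendieckTopology.discrete _)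
    {C : Comm P} (hC : ∀ D : Comm P, Nonempty (C ⟶ D)) : ⊥ ∉ J (op C) := by
  refine fun h => hd (top_le_iff.1 fun A S _ => (hT A.unop S).2 ((jkCovering_iff hP).2 ?_))
  obtain ⟨f⟩ := hC A.unop.center
  exact mem_of_bot_mem J h f.op _

lemma baseChangeHasDegree_of_hasConstantDegree {A : Azu P} {n : ℕ+}
    (h : HasConstantDegree (Subalgebra.center ℂ A) A n) {D : Comm P} (f : A.center ⟶ D) :
    BaseChangeHasDegree A f n :=
  (baseChangeHasDegree_iff _ _ _).2 fun _ => h _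

end Discrete

section Comm

variable (hP : IsClosedUnderFiniteType P) {J : GrothendieckTopology (Comm P)ᵒᵖ}
  {K : GrothendieckTopology DivPoset} {T : GrothendieckTopology (Azu P)ᵒᵖ}

/-- The morphisms that induce a morphism in `U` on centers. -/
def centerSieve {A : Azu P} (U : Sieve (op A.center)) : Sieve (op A) where
  arrows _ h := U (Azu.centerMap h.unop).op
  downward_closed h g := U.downward_closed h (Azu.centerMap g.unop).op

namespace Azu

variable (D : Comm P) (B : Type u) [Ring B] [Algebra D.obj B] [IsAzumaya D.obj B]

/-- The inverse of `fromCenter`. -/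
def toCenter : D ⟶ (ofBase hP D B).center :=
  letI : Algebra ℂ B := Algebra.compHom B (algebraMap ℂ D.obj)
  haveI : IsScalarTower ℂ D.obj B := IsScalarTower.of_algebraMap_eq fun _ => rfl
  Comm.homMk (C := D) (D := (ofBase hP D B).center) (baseToCenter D B)

lemma toCenter_fromCenter : toCenter hP D B ≫ fromCenter hP D B = 𝟙 D :=
  Comm.hom_ext fun _ => FaithfulSMul.algebraMap_injective D.obj B
    (algebraMap_fromCenter hP D B _)

variable {D}

lemma centerMap_homOver {A : Azu P} (f : A.center ⟶ D) (ψ : A →+* B)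
    (hψ : ∀ z : Subalgebra.center ℂ A, ψ z = algebraMap D.obj B (Comm.ringHom f z)) :
    centerMap (homOver hP B f ψ hψ) = f ≫ toCenter hP D B :=
  Comm.hom_ext fun z => Subtype.ext (hψ z)

end Azu

include hP in
lemma represented_centerSieve_iff {A : Azu P} {U : Sieve (op A.center)} {D : Comm P}
    {f : A.center ⟶ D} {n m : ℕ+} (hn : BaseChangeHasDegree A f n) (hm : n ∣ m) :
    Represented A (centerSieve U) f m ↔ U f.op := by
  constructor
  · intro h
    obtain ⟨B, _, _, _, ψ, hψ, hS, -⟩ := h.exists_homOver hP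
    rw [← Azu.centerMap_homOver_fromCenter hP B f ψ hψ]
    exact U.downward_closed hS (Azu.fromCenter hP D B).op
  · intro h
    refine Represented.of_dvd hP ?_ hm
    obtain ⟨B, _, _, _, ψ, hψ, hB, -⟩ := exists_baseChange A f
    refine represented_of_homOver hP B ψ hψ ?_ (hB n hn)
    change U (Azu.centerMap (Azu.homOver hP B f ψ hψ)).op
    rw [Azu.centerMap_homOver]
    exact U.downward_closed h (Azu.toCenter hP D B).op

include hP in
lemma centerSieve_mem_iff (hJK : Admissible J K) (hT : IsTopologyJK J K T)
    (hd : T ≠ GrothendieckTopology.discrete _) {A : Azu P}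
    (hA : HasConstantDegree (Subalgebra.center ℂ A) A 1) (U : Sieve (op A.center)) :
    centerSieve U ∈ T (op A) ↔ U ∈ J (op A.center) := by
  have hn : ∀ {D : Comm P} (f : A.center ⟶ D), BaseChangeHasDegree A f 1 :=
    baseChangeHasDegree_of_hasConstantDegree hA
  rw [hT, jkCovering_iff hP]
  constructor
  · refine fun h => mem_of_local hP hJK.zariski_le h fun D f hD hf => ?_
    refine J.covering_of_eq_top (Sieve.pullback_eq_top_of_mem _ ?_)
    obtain ⟨n, hfn, h⟩ := (centrallyCovered_iff hP).1 hf
    obtain rfl := hfn.unique (hn f)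
    by_contra hU
    refine bot_notMem_divPoset hP hT hJK.zariski_le hd (K.superset_covering ?_ h)
    exact fun m _ hm => (hU ((represented_centerSieve_iff hP hfn (one_dvd _)).1 hm)).elim
  · refine fun h => J.superset_covering (fun D f hf => ?_) h
    refine (centrallyCovered_iff hP).2 ⟨1, hn f.unop, K.superset_covering ?_ (K.top_mem _)⟩
    exact fun m _ _ => (represented_centerSieve_iff hP (hn f.unop) (one_dvd _)).2 hf

include hP in
lemma eq_of_isTopologyJK {J' : GrothendieckTopology (Comm P)ᵒᵖ} {K' : GrothendieckTopology DivPoset}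
    (hJK : Admissible J K) (hT : IsTopologyJK J K T) (hJK' : Admissible J' K')
    (hT' : IsTopologyJK J' K' T) (hd : T ≠ GrothendieckTopology.discrete _) : J = J' := by
  have key : ∀ {J : GrothendieckTopology (Comm P)ᵒᵖ} {K : GrothendieckTopology DivPoset}
      (_ : Admissible J K) (_ : IsTopologyJK J K T) (C : Comm P) (U : Sieve (op C)),
      U ∈ J (op C) ↔ centerSieve (U.pullback (Azu.toCenter hP C C.obj).op) ∈
        T (op (Azu.ofBase hP C C.obj)) := fun {J K} hJK hT C U => by
    rw [centerSieve_mem_iff hP hJK hT hd (Azu.hasConstantDegree_over hP C C.obj fun p => by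
      have := p.nontrivial
      rw [Module.rankAtStalk_eq_finrank_of_free, Pi.natCast_apply]
      simp)]
    refine ⟨J.pullback_stable _, fun h => ?_⟩
    have h' := J.pullback_stable (Azu.fromCenter hP C C.obj).op h
    rwa [← Sieve.pullback_comp, ← op_comp, Azu.toCenter_fromCenter, op_id, Sieve.pullback_id] at h'
  ext C U
  exact (key hJK hT C.unop U).trans (key hJK' hT' C.unop U).symm

end Comm

section DivPoset

variable (hP : IsClosedUnderFiniteType P) {J : GrothendieckTopology (Comm P)ᵒᵖ}
  {K : GrothendieckTopology DivPoset} {T : GrothendieckTopology (Azu P)ᵒᵖ}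

/-- The complex numbers. -/
def Comm.base : Comm P := ⟨CommAlgCat.of ℂ (ULift.{u} ℂ), hP.base⟩

instance isAzumaya_matrix_pnat (n : ℕ+) :
    IsAzumaya (Comm.base hP).obj (Matrix (Fin n) (Fin n) (Comm.base hP).obj) :=
  haveI : Nonempty (Fin n) := ⟨⟨0, n.pos⟩⟩
  IsAzumaya.matrix _ _

/-- The algebra of complex matrices of size `n`. -/
def Azu.matrix (n : ℕ+) : Azu P :=
  Azu.ofBase hP (Comm.base hP) (Matrix (Fin n) (Fin n) (Comm.base hP).obj)

lemma Azu.hasConstantDegree_matrix (n : ℕ+) :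
    HasConstantDegree (Subalgebra.center ℂ (Azu.matrix hP n)) (Azu.matrix hP n) n :=
  Azu.hasConstantDegree_over hP _ _ (AzuTop.hasConstantDegree_matrix _ n)

lemma Azu.center_matrix_nonempty_hom (n : ℕ+) (D : Comm P) :
    Nonempty ((Azu.matrix hP n).center ⟶ D) :=
  ⟨Azu.fromCenter hP _ _ ≫ Comm.homMk (C := Comm.base hP) (D := D)
    ((Algebra.ofId ℂ D.obj).comp (ULift.algEquiv (R := ℂ) (A := ℂ)).toAlgHom)⟩

instance Azu.center_matrix_subsingleton_hom (n : ℕ+) (D : Comm P) :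
    Subsingleton ((Azu.matrix hP n).center ⟶ D) := by
  refine ⟨fun f g => Comm.hom_ext fun z => ?_⟩
  obtain ⟨c, rfl⟩ : ∃ c : ℂ, algebraMap ℂ (Azu.matrix hP n).center.obj c = z := by
    obtain ⟨c, hc⟩ := (Azu.mem_center_over hP (Comm.base hP)
      (Matrix (Fin n) (Fin n) (Comm.base hP).obj) z.1).1 z.2
    exact ⟨c.down, Subtype.ext hc⟩
  rw [Comm.ringHom_algebraMap, Comm.ringHom_algebraMap]

lemma Azu.matrix_nonempty_hom {n m : ℕ+} (h : n ∣ m) :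
    Nonempty (Azu.matrix hP n ⟶ Azu.matrix hP m) := by
  obtain ⟨k, rfl⟩ := h
  obtain ⟨b⟩ := exists_matrix_hom (Comm.base hP).obj n k
  exact ⟨Azu.homOver hP (A := Azu.matrix hP n)
    (Matrix (Fin (n * k : ℕ+)) (Fin (n * k : ℕ+)) (Comm.base hP).obj)
    (Azu.fromCenter hP _ _) b.toRingHom fun z =>
      (congrArg b (Azu.algebraMap_fromCenter hP _ _ z).symm).trans (b.commutes _)⟩

/-- The morphisms from the complex matrices of size `n` to the algebras that contain matrices of a
size in `V`. -/
def matrixSieve (n : ℕ+) (V : Sieve (⟨n⟩ : DivPoset)) : Sieve (op (Azu.matrix hP n)) where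
  arrows B _ := ∃ (m : DivPoset) (g : m ⟶ ⟨n⟩), V g ∧ Nonempty (Azu.matrix hP m.val ⟶ B.unop)
  downward_closed := fun ⟨m, g, hV, ⟨e⟩⟩ j => ⟨m, g, hV, ⟨e ≫ j.unop⟩⟩

lemma representedSieve_matrixSieve (n : ℕ+) (V : Sieve (⟨n⟩ : DivPoset)) {D : Comm P}
    [Nontrivial D.obj] (f : (Azu.matrix hP n).center ⟶ D) :
    representedSieve hP (matrixSieve hP n V) f n = V := by
  ext m g
  constructor
  · intro h
    obtain ⟨B, _, _, _, ψ, hψ, ⟨l, w, hl, ⟨e⟩⟩, hm⟩ := Represented.exists_homOver hP h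
    have hd : l.val ∣ m.val := (baseChangeHasDegree_of_hasConstantDegree
      (Azu.hasConstantDegree_matrix hP l.val) _).dvd (h := e)
        (Azu.baseChangeHasDegree_fromCenter hP B hm)
    exact V.downward_closed hl (homOfLE hd : m ⟶ l)
  · intro hg
    obtain ⟨j⟩ := Azu.matrix_nonempty_hom hP (leOfHom g)
    obtain ⟨e⟩ := Azu.center_matrix_nonempty_hom hP m.val D
    have hj : matrixSieve hP n V j.op := ⟨m, g, hg, ⟨𝟙 _⟩⟩
    have h : Represented _ ((matrixSieve hP n V).pullback j.op) e m.val := by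
      rw [Sieve.pullback_eq_top_of_mem _ hj]
      exact represented_top hP
        (baseChangeHasDegree_of_hasConstantDegree (Azu.hasConstantDegree_matrix hP m.val) e)
    have h' := Represented.of_pullback hP j h
    rwa [Subsingleton.elim (Azu.centerMap j ≫ e) f] at h'

lemma matrixSieve_mem_iff (hJK : Admissible J K) (hT : IsTopologyJK J K T)
    (hd : T ≠ GrothendieckTopology.discrete _) (n : ℕ+) (V : Sieve (⟨n⟩ : DivPoset)) :
    matrixSieve hP n V ∈ T (op (Azu.matrix hP n)) ↔ V ∈ K ⟨n⟩ := by
  have hn : ∀ {D : Comm P} (f : (Azu.matrix hP n).center ⟶ D), BaseChangeHasDegree _ f n :=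
    baseChangeHasDegree_of_hasConstantDegree (Azu.hasConstantDegree_matrix hP n)
  rw [hT, jkCovering_iff hP]
  constructor
  · intro h
    by_contra hV
    refine bot_notMem_comm hP hT hd (Azu.center_matrix_nonempty_hom hP n)
      (mem_of_local hP hJK.zariski_le h fun D f hD hf => (hV ?_).elim)
    obtain ⟨m, hm, h⟩ := (centrallyCovered_iff hP).1 hf
    obtain rfl := hm.unique (hn f)
    exact representedSieve_matrixSieve hP m V f ▸ h
  · refine fun h => mem_of_local hP hJK.zariski_le (J.top_mem _) fun D f hD _ => ?_
    refine J.covering_of_eq_top (Sieve.pullback_eq_top_of_mem _ ?_)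
    refine (centrallyCovered_iff hP).2 ⟨n, hn f, ?_⟩
    rw [representedSieve_matrixSieve]
    exact h

include hP in
lemma eq_of_isTopologyJK_divPoset {J' : GrothendieckTopology (Comm P)ᵒᵖ}
    {K' : GrothendieckTopology DivPoset} (hJK : Admissible J K) (hT : IsTopologyJK J K T)
    (hJK' : Admissible J' K') (hT' : IsTopologyJK J' K' T)
    (hd : T ≠ GrothendieckTopology.discrete _) : K = K' := by
  ext n V
  exact (matrixSieve_mem_iff hP hJK hT hd n.val V).symm.trans
    (matrixSieve_mem_iff hP hJK' hT' hd n.val V)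

end DivPoset

end AzuTop

end

theorem mainTheorem3 (P : ObjectProperty (CommAlgCat.{u} ℂ))
    (hP : P = ⊤ ∨ P = AzuTop.finitelyGenerated) :
    (∀ (J : GrothendieckTopology (AzuTop.Comm P)ᵒᵖ) (K : GrothendieckTopology AzuTop.DivPoset),
      AzuTop.Admissible J K →
        ∃ T : GrothendieckTopology (AzuTop.Azu P)ᵒᵖ, AzuTop.IsTopologyJK J K T) ∧
    (∀ (J J' : GrothendieckTopology (AzuTop.Comm P)ᵒᵖ)
      (K K' : GrothendieckTopology AzuTop.DivPoset),
      AzuTop.Admissible J K → AzuTop.Admissible J' K' →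
      ∀ T T' : GrothendieckTopology (AzuTop.Azu P)ᵒᵖ,
        AzuTop.IsTopologyJK J K T → AzuTop.IsTopologyJK J' K' T' →
        T = T' → T ≠ GrothendieckTopology.discrete _ → J = J' ∧ K = K') := by
  have hP' := AzuTop.isClosedUnderFiniteType hP
  refine ⟨fun J K h => ⟨_, AzuTop.isTopologyJK_jkTopology hP' h⟩, ?_⟩
  rintro J J' K K' h h' T _ hT hT' rfl hd
  exact ⟨AzuTop.eq_of_isTopologyJK hP' h hT h' hT' hd,
    AzuTop.eq_of_isTopologyJK_divPoset hP' h hT h' hT' hd⟩
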